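/- Let $G$ be a finitely generated group with a finite symmetric generating set $S$, and let $B_G(n)$ be the ball of radius $n$ around the identity for the associated word metric. For a $G$-set $X$ put $\mathrm{vol}_{G,X}(n)=\max_{x\in X}|B_G(n)\cdot x|$ (with value $0$ if $X=\emptyset$). Let $\mathcal C(\mathrm{lin})$ be the class of finitely generated groups $G$ that admit a faithful action of (at most) linear growth, i.e. a faithful $G$-set $X$ for which there is a constant $C>0$ such that $\mathrm{vol}_{G,X}(n)\le Cn$ for all $n\ge 1$; this does not depend on the choice of $S$. For a finite simple graph $\Gamma$ with vertex set $I$ and a family of groups $(G_i)_{i\in I}$, the graph product of the $G_i$ along $\Gamma$ is the quotient of the free product $\ast_{i\in I}G_i$ by the normal closure of all commutators $[g,h]$ with $g\in G_i$, $h\in G_j$ and $i,j$ adjacent in $\Gamma$. For an arbitrary simple graph $\Gamma$, the right-angled Artin group of $\Gamma$ is the group with one generator for each vertex and the relations that two generators commute when the corresponding vertices are adjacent. The Grigorchuk group is the group of automorphisms of the rooted binary tree $\{0,1\}^*$ generated by $a,b,c,d$, which fix the empty word and satisfy $$a(0w)=1w,\ a(1w)=0w;\quad b(0w)=0a(w),\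 b(1w)=1c(w);\quad c(0w)=0a(w),\ c(1w)=1d(w);\quad d(0w)=0w,\ d(1w)=1b(w).$$ **Proposition 1.2.** Let $(G_i)_{i\in I}$ be a finite family of groups such that each $G_i$ is isomorphic to one of the following: - a finite group; - a finitely generated abelian group; - a finitely generated subgroup of a right-angled Artin group; - the Grigorchuk group; - the lamplighter group $(\mathbb Z/p\mathbb Z)\wr\mathbb Z=\left(\bigoplus_{\mathbb Z}\mathbb Z/p\mathbb Z\right)\rtimes\mathbb Z$ for some integer $p\ge 2$. Then the free product $\ast_{i\in I}G_i$ belongs to $\mathcal C(\mathrm{lin})$. More generally, for every simple graph $\Gamma$ with vertex set $I$, the graph product of the $G_i$ along $\Gamma$ belongs to $\mathcal C(\mathrm{lin})$. -/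

import Mathlib

universe u v w

noncomputable section

namespace ActionGrowth

/-! ## Growth of actions -/

/-- `S` is a finite symmetric generating set of the group `G`. -/
structure IsFiniteSymmGenSet {G : Type u} [Group G] (S : Set G) : Prop where
  finite : S.Finite
  symm : ∀ s ∈ S, s⁻¹ ∈ S
  closure_eq_top : Subgroup.closure S = ⊤

/-- The ball of radius `n` around the identity for the word metric associated to the symmetric
generating set `S`: all products of at most `n` elements of `S`. -/
def wordBall {G : Type u} [Group G] (S : Set G) (n : ℕ) : Set G :=
  {g | ∃ l : List G, l.length ≤ n ∧ (∀ s ∈ l, s ∈ S) ∧ l.prod = g}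

/-- The volume of the largest ball of radius `n` in the Schreier graph of the action of `G` on `X`
(with respect to `S`), that is `max_x |B_G(n) • x|`. When `S` is finite the cardinalities are finite
and bounded by that of `B_G(n)`, so that the supremum is a maximum as soon as `X` is nonempty. -/
def vol {G : Type u} [Group G] (S : Set G) (X : Type v) [MulAction G X] (n : ℕ) : ℕ :=
  ⨆ x : X, ((fun g : G => g • x) '' wordBall S n).ncard

/-- `f₁ ≼ f₂`: there is `C > 0` such that `f₁ n ≤ C f₂ (C n)` for all `n ≥ 1`.
(The radius `n = 0` is left out, so that `n ↦ n` is an admissible bound: balls of radius `0` have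
one point.) -/
def GrowthLE (f₁ f₂ : ℕ → ℕ) : Prop :=
  ∃ C : ℕ, 0 < C ∧ ∀ n : ℕ, 1 ≤ n → f₁ n ≤ C * f₂ (C * n)

/-- The class `C(f)`: finitely generated groups `G` that admit a faithful `G`-set `X` whose growth
satisfies `vol_{G, X} ≼ f`. The growth bound is required for all finite symmetric generating sets
(equivalently, for one of them). -/
def ClassC (f : ℕ → ℕ) (G : Type u) [Group G] : Prop :=
  Group.FG G ∧
    ∃ (X : Type u) (_ : MulAction G X), FaithfulSMul G X ∧
      ∀ S : Set G, IsFiniteSymmGenSet S → GrowthLE (vol S X) f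

/-- The class `C(lin)` of finitely generated groups with a faithful action of linear growth. -/
def ClassCLin (G : Type u) [Group G] : Prop :=
  ClassC (fun n => n) G

/-! ## Graph products -/

/-- The commutators `[g, h]` in the free product of the `G i`, where `g ∈ G i`, `h ∈ G j` and
`i, j` are adjacent. -/
def graphProductRels {ι : Type w} (Γ : SimpleGraph ι) (G : ι → Type u) [∀ i, Group (G i)] :
    Set (Monoid.CoprodI G) :=
  {x | ∃ i j : ι, Γ.Adj i j ∧ ∃ (g : G i) (h : G j),
    x = Monoid.CoprodI.of g * Monoid.CoprodI.of h *
      (Monoid.CoprodI.of g)⁻¹ * (Monoid.CoprodI.of h)⁻¹}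

/-- The graph product of the groups `G i` along the simple graph `Γ`: the quotient of the free
product by the relations `[G i, G j] = 1` for all adjacent `i, j`. -/
abbrev GraphProduct {ι : Type w} (Γ : SimpleGraph ι) (G : ι → Type u) [∀ i, Group (G i)] :
    Type (max w u) :=
  Monoid.CoprodI G ⧸ Subgroup.normalClosure (graphProductRels Γ G)

/-- The right-angled Artin group of `Γ`: the graph product along `Γ` of infinite cyclic groups,
i.e. one generator for each vertex, two generators commuting when the vertices are adjacent. -/
abbrev RAAG {V : Type v} (Γ : SimpleGraph V) : Type v :=
  GraphProduct Γ (fun _ : V => Multiplicative ℤ)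

/-! ## The Grigorchuk group

The vertices of the rooted binary tree are the finite binary words, `false` standing for the
digit `0` and `true` for the digit `1`. -/

/-- `a(0w) = 1w`, `a(1w) = 0w`. -/
def grigAFun : List Bool → List Bool
  | [] => []
  | x :: t => (!x) :: t

mutual

/-- `b(0w) = 0a(w)`, `b(1w) = 1c(w)`. -/
def grigBFun : List Bool → List Bool
  | [] => []
  | false :: t => false :: grigAFun t
  | true :: t => true :: grigCFun t

/-- `c(0w) = 0a(w)`, `c(1w) = 1d(w)`. -/
def grigCFun : List Bool → List Bool
  | [] => []
  | false :: t => false :: grigAFun t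
  | true :: t => true :: grigDFun t

/-- `d(0w) = 0w`, `d(1w) = 1b(w)`. -/
def grigDFun : List Bool → List Bool
  | [] => []
  | false :: t => false :: t
  | true :: t => true :: grigBFun t

end

theorem grigAFun_involutive : Function.Involutive grigAFun := by
  intro t
  cases t <;> simp [grigAFun]

theorem grigBCDFun_involutive (t : List Bool) :
    grigBFun (grigBFun t) = t ∧ grigCFun (grigCFun t) = t ∧ grigDFun (grigDFun t) = t := by
  induction t with
  | nil => simp [grigBFun, grigCFun, grigDFun]
  | cons x t ih =>
    obtain ⟨hb, hc, hd⟩ := ih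
    have ha := grigAFun_involutive t
    cases x <;> simp [grigBFun, grigCFun, grigDFun, ha, hb, hc, hd]

def grigA : Equiv.Perm (List Bool) :=
  grigAFun_involutive.toPerm

def grigB : Equiv.Perm (List Bool) :=
  Function.Involutive.toPerm grigBFun (fun t => (grigBCDFun_involutive t).1)

def grigC : Equiv.Perm (List Bool) :=
  Function.Involutive.toPerm grigCFun (fun t => (grigBCDFun_involutive t).2.1)

def grigD : Equiv.Perm (List Bool) :=
  Function.Involutive.toPerm grigDFun (fun t => (grigBCDFun_involutive t).2.2)

/-- The Grigorchuk group, generated by the automorphisms `a, b, c, d` of the rooted binary tree.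
(The automorphism group of the tree is a subgroup of the group of permutations of its vertices.) -/
def grigorchukGroup : Subgroup (Equiv.Perm (List Bool)) :=
  Subgroup.closure {grigA, grigB, grigC, grigD}

/-! ## Lamplighter groups -/

/-- The shift action of `ℤ` on the finitely supported functions `ℤ → ℤ/p`:
`n` sends `f` to `m ↦ f (m - n)`. -/
def lampShift (p : ℕ) : Multiplicative ℤ →* MulAut (Multiplicative (ℤ →₀ ZMod p)) where
  toFun n := AddEquiv.toMultiplicative (Finsupp.domCongr (Equiv.addRight (Multiplicative.toAdd n)))
  map_one' := by
    refine MulEquiv.ext fun f => Multiplicative.toAdd.injective (Finsupp.ext fun m => ?_)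
    change (Multiplicative.toAdd f) (m + -(0 : ℤ)) = (Multiplicative.toAdd f) m
    simp
  map_mul' a b := by
    refine MulEquiv.ext fun f => Multiplicative.toAdd.injective (Finsupp.ext fun m => ?_)
    change (Multiplicative.toAdd f) (m + -(Multiplicative.toAdd a + Multiplicative.toAdd b)) =
      (Multiplicative.toAdd f) (m + -Multiplicative.toAdd a + -Multiplicative.toAdd b)
    congr 1
    ring

/-- The lamplighter group `(ℤ/p) ≀ ℤ`, i.e. the restricted wreath product `(⨁_ℤ ℤ/p) ⋊ ℤ`. -/
abbrev Lamplighter (p : ℕ) : Type :=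
  Multiplicative (ℤ →₀ ZMod p) ⋊[lampShift p] Multiplicative ℤ

/-! ## The allowed factors -/

/-- `G` is isomorphic to one of: a finite group; a finitely generated abelian group; a finitely
generated subgroup of a right-angled Artin group; the Grigorchuk group; the lamplighter group
`(ℤ/p) ≀ ℤ` for some `p ≥ 2`. -/
def IsListedGroup (G : Type u) [Group G] : Prop :=
  Finite G ∨
  (Group.FG G ∧ ∀ a b : G, a * b = b * a) ∨
  (∃ (V : Type v) (Γ : SimpleGraph V) (H : Subgroup (RAAG Γ)), H.FG ∧ Nonempty (G ≃* H)) ∨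
  Nonempty (G ≃* grigorchukGroup) ∨
  (∃ p : ℕ, 2 ≤ p ∧ Nonempty (G ≃* Lamplighter p))

end ActionGrowth

end

namespace ActionGrowth

open Equiv

/-! ## Linearly separated groups -/

-- The property that survives the construction is `LinSep`: every g ≠ 1 moves a point x of some
-- G-set carrying a height f with f x = 0, f maximal and positive at g x, boundedly many points at
-- each height, and a bound L s on the change of height under s; neither the fibre bound nor L
-- depends on g. A ball of radius n around y meets only heights within O(n) of f y, so it has O(n)
-- points, and the disjoint union of these sets over all g ≠ 1 is faithful of linear growth
-- (`LinSep.classCLin`).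
--
-- Uniform `LinSep` passes to graph products (`LinSep.graphProduct`). A geodesic word is read from
-- right to left. A letter of G_i that commutes with the piece reached last fixes the current end
-- point; any other letter has a separating G_i-set, whose bottom is glued to the current end point
-- and whose top becomes the new one. Heights add up along the chain, and fibres of consecutive
-- pieces overlap only at the height of a junction, so the fibre bound merely doubles, whatever the
-- length of the word. The edgeless graph gives the free product.
--
-- For the factors, it suffices to have a Lipschitz map with bounded fibres to ℤ/2D sending x and g
-- x to antipodal points (`separates_of_antipodal`), or to ℤ with range comparable to the distance
-- between the values at x and g x (`separates_of_range`). Translations of ℤ/2n handle ℤ, hence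
-- finitely generated abelian groups and, via graph products, subgroups of right-angled Artin
-- groups. For the lamplighter group, a configuration is folded modulo the first power of two at
-- which it stays nonzero; it then has a lit lamp far from 0 (`exists_foldLamps_ne_zero`). For the
-- Grigorchuk group, levels of the tree are lines ordered by a Gray code, and a parity argument
-- shows that a nontrivial element moves some vertex across a definite fraction of such a line
-- (`exists_moved_far`).

/-- The function `f` separates the point `x` of a `G`-set from its image under `g`: it is minimal
at `x`, maximal at `g • x`, changes by a bounded amount under each element of the group, and has
fibres with at most `C` points. -/
structure Separates {G : Type u} [Group G] (C : ℕ) (L : G → ℕ) (g : G) {X : Type}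
    (ρ : G →* Perm X) (f : X → ℕ) (x : X) : Prop where
  base : f x = 0
  pos : 0 < f (ρ g x)
  le : ∀ y, f y ≤ f (ρ g x)
  lipschitz : ∀ s y, f (ρ s y) ≤ f y + L s
  fiber : ∀ k, {y | f y = k}.encard ≤ C

/-- Every nontrivial element of `G` moves a point of a finite `G`-set to a point at a distance
comparable to the size of the set. -/
def LinSep (C : ℕ) (G : Type u) [Group G] : Prop :=
  ∃ L : G → ℕ, ∀ g : G, g ≠ 1 → ∃ (X : Type) (ρ : G →* Perm X) (f : X → ℕ) (x : X),
    Separates C L g ρ f x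

theorem Separates.mono {G : Type u} [Group G] {C C' : ℕ} {L L' : G → ℕ} {g : G} {X : Type}
    {ρ : G →* Perm X} {f : X → ℕ} {x : X} (h : Separates C L g ρ f x) (hC : C ≤ C')
    (hL : ∀ s, L s ≤ L' s) : Separates C' L' g ρ f x where
  base := h.base
  pos := h.pos
  le := h.le
  lipschitz s y := (h.lipschitz s y).trans (Nat.add_le_add_left (hL s) _)
  fiber k := (h.fiber k).trans (by exact_mod_cast hC)

theorem Separates.comp {G : Type u} [Group G] {H : Type v} [Group H] {C : ℕ} {L : H → ℕ}
    (φ : G →* H) {g : G} {X : Type} {ρ : H →* Perm X} {f : X → ℕ} {x : X}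
    (h : Separates C L (φ g) ρ f x) : Separates C (fun s => L (φ s)) g (ρ.comp φ) f x where
  base := h.base
  pos := h.pos
  le := h.le
  lipschitz s y := h.lipschitz (φ s) y
  fiber := h.fiber

theorem LinSep.mono {G : Type u} [Group G] {C C' : ℕ} (h : LinSep C G) (hC : C ≤ C') :
    LinSep C' G := by
  obtain ⟨L, hL⟩ := h
  refine ⟨L, fun g hg => ?_⟩
  obtain ⟨X, ρ, f, x, hs⟩ := hL g hg
  exact ⟨X, ρ, f, x, hs.mono hC fun _ => le_rfl⟩

theorem LinSep.of_separating {G : Type u} [Group G] {κ : Type w} [Finite κ] {H : κ → Type v}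
    [∀ k, Group (H k)] {C : ℕ} (hH : ∀ k, LinSep C (H k)) (φ : ∀ k, G →* H k)
    (hφ : ∀ g : G, g ≠ 1 → ∃ k, φ k g ≠ 1) : LinSep C G := by
  have := Fintype.ofFinite κ
  choose L hL using hH
  refine ⟨fun s => ∑ k, L k (φ k s), fun g hg => ?_⟩
  obtain ⟨k, hk⟩ := hφ g hg
  obtain ⟨X, ρ, f, x, hs⟩ := hL k (φ k g) hk
  exact ⟨X, ρ.comp (φ k), f, x, hs.comp.mono le_rfl fun s =>
    Finset.single_le_sum (f := fun k => L k (φ k s)) (fun _ _ => Nat.zero_le _)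
      (Finset.mem_univ k)⟩

theorem LinSep.of_injective {G : Type u} [Group G] {H : Type v} [Group H] {C : ℕ}
    (hH : LinSep C H) (φ : G →* H) (hφ : Function.Injective φ) : LinSep C G :=
  LinSep.of_separating (κ := Unit) (fun _ => hH) (fun _ => φ)
    fun _ hg => ⟨(), fun h => hg (hφ (h.trans (map_one φ).symm))⟩

/-- A Lipschitz condition on generators extends to the whole group, uniformly in the action. -/
theorem exists_lipschitz_of_closure {G : Type u} [Group G] {T : Set G}
    (hT : Subgroup.closure T = ⊤) (K : G → ℕ) (h : G) :
    ∃ L : ℕ, ∀ (X : Type) (ρ : G →* Perm X) (f : X → ℕ),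
      (∀ s ∈ T, ∀ y, f (ρ s y) ≤ f y + K s ∧ f y ≤ f (ρ s y) + K s) →
        ∀ y, f (ρ h y) ≤ f y + L ∧ f y ≤ f (ρ h y) + L := by
  have hmem : h ∈ Subgroup.closure T := hT ▸ Subgroup.mem_top h
  induction hmem using Subgroup.closure_induction with
  | mem s hs => exact ⟨K s, fun X ρ f hf => hf s hs⟩
  | one => exact ⟨0, fun X ρ f _ y => by simp⟩
  | mul a b _ _ iha ihb =>
    obtain ⟨La, ha⟩ := iha
    obtain ⟨Lb, hb⟩ := ihb
    refine ⟨La + Lb, fun X ρ f hf y => ?_⟩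
    have h1 := ha X ρ f hf (ρ b y)
    have h2 := hb X ρ f hf y
    rw [map_mul, Perm.mul_apply]
    omega
  -- The second inequality of the hypothesis is what bounds the effect of an inverse.
  | inv a _ iha =>
    obtain ⟨La, ha⟩ := iha
    refine ⟨La, fun X ρ f hf y => ?_⟩
    have h1 := ha X ρ f hf (ρ a⁻¹ y)
    rw [← Perm.mul_apply, ← map_mul, mul_inv_cancel, map_one, Perm.one_apply] at h1
    omega

/-- It suffices to have the Lipschitz condition on generators. -/
theorem LinSep.of_closure {G : Type u} [Group G] {C : ℕ} {T : Set G}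
    (hT : Subgroup.closure T = ⊤) (K : G → ℕ)
    (h : ∀ g : G, g ≠ 1 → ∃ (X : Type) (ρ : G →* Perm X) (f : X → ℕ) (x : X),
      f x = 0 ∧ 0 < f (ρ g x) ∧ (∀ y, f y ≤ f (ρ g x)) ∧
      (∀ s ∈ T, ∀ y, f (ρ s y) ≤ f y + K s ∧ f y ≤ f (ρ s y) + K s) ∧
      ∀ k, {y | f y = k}.encard ≤ C) : LinSep C G := by
  choose L hL using exists_lipschitz_of_closure hT K
  refine ⟨L, fun g hg => ?_⟩
  obtain ⟨X, ρ, f, x, h0, h1, h2, h3, h4⟩ := h g hg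
  exact ⟨X, ρ, f, x, h0, h1, h2, fun s y => (hL s X ρ f h3 y).1, h4⟩

/-! ## Linear growth -/

theorem apply_le_of_mem_wordBall {G : Type u} [Group G] {S : Set G} {M : ℕ} {L : G → ℕ}
    (hM : ∀ s ∈ S, L s ≤ M) {X : Type} {ρ : G →* Perm X} {f : X → ℕ}
    (hf : ∀ s y, f (ρ s y) ≤ f y + L s) {n : ℕ} {h : G} (hh : h ∈ wordBall S n) (y : X) :
    f (ρ h y) ≤ f y + n * M := by
  obtain ⟨l, hl, hS, rfl⟩ := hh
  have key : f (ρ l.prod y) ≤ f y + l.length * M := by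
    clear hl
    induction l with
    | nil => simp
    | cons s l ih =>
      have h1 := ih fun t ht => hS t (List.mem_cons_of_mem _ ht)
      have h2 := hf s (ρ l.prod y)
      have h3 := hM s (hS s List.mem_cons_self)
      rw [List.prod_cons, map_mul, Perm.mul_apply, List.length_cons, Nat.succ_mul]
      omega
  exact key.trans (Nat.add_le_add_left (Nat.mul_le_mul_right _ hl) _)

theorem inv_mem_wordBall {G : Type u} [Group G] {S : Set G} (hS : ∀ s ∈ S, s⁻¹ ∈ S) {n : ℕ}
    {h : G} (hh : h ∈ wordBall S n) : h⁻¹ ∈ wordBall S n := by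
  obtain ⟨l, hl, hlS, rfl⟩ := hh
  refine ⟨(l.map fun s => s⁻¹).reverse, by simpa using hl, ?_, (List.prod_inv_reverse l).symm⟩
  intro s hs
  obtain ⟨t, ht, rfl⟩ := List.mem_map.1 (List.mem_reverse.1 hs)
  exact hS t (hlS t ht)

theorem encard_le_of_fiber {X Y : Type*} {f : X → Y} {C : ℕ}
    (hf : ∀ k, {y | f y = k}.encard ≤ C) (s : Finset Y) :
    {y | f y ∈ s}.encard ≤ (C * s.card : ℕ) := by
  classical
  induction s using Finset.induction_on with
  | empty => simp
  | insert a s ha ih =>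
    have : {y | f y ∈ insert a s} = {y | f y = a} ∪ {y | f y ∈ s} := by
      ext y; simp
    rw [this, Finset.card_insert_of_notMem ha, Nat.mul_succ, Nat.add_comm, Nat.cast_add]
    exact (Set.encard_union_le _ _).trans (add_le_add (hf a) ih)

/-- Take the disjoint union of the separating sets over all g ≠ 1. It is faithful because b⁻¹a moves
its own base point, and a ball stays in one summand, inside a window of heights. The pieces live in
`Type`, so the union lives in the universe of G. -/
theorem LinSep.classCLin {G : Type u} [Group G] {C : ℕ} (h : LinSep C G) (hG : Group.FG G) :
    ClassCLin G := by
  obtain ⟨L, hL⟩ := h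
  choose X ρ f x hs using fun g : {g : G // g ≠ 1} => hL g.1 g.2
  let act : MulAction G (Σ g, X g) :=
    { smul := fun h p => ⟨p.1, ρ p.1 h p.2⟩
      one_smul := fun p => by
        change (⟨p.1, ρ p.1 1 p.2⟩ : Σ g, X g) = p
        rw [map_one]; rfl
      mul_smul := fun a b p => by
        change (⟨p.1, ρ p.1 (a * b) p.2⟩ : Σ g, X g) = ⟨p.1, ρ p.1 a (ρ p.1 b p.2)⟩
        rw [map_mul]; rfl }
  have smul_def : ∀ (h : G) (g) (y : X g), h • (⟨g, y⟩ : Σ g, X g) = ⟨g, ρ g h y⟩ :=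
    fun _ _ _ => rfl
  refine ⟨hG, Σ g, X g, act, ⟨fun {a b} hab => ?_⟩, fun S hS => ?_⟩
  · by_contra hne
    have h1 : b⁻¹ * a ≠ 1 := fun h => hne (inv_mul_eq_one.1 h).symm
    have h2 := hab ⟨⟨_, h1⟩, x ⟨_, h1⟩⟩
    rw [← inv_smul_eq_iff, smul_smul, smul_def] at h2
    have h3 : ρ ⟨_, h1⟩ (b⁻¹ * a) (x ⟨_, h1⟩) = x ⟨_, h1⟩ := by simpa using h2
    have h4 := (hs ⟨_, h1⟩).pos
    rw [h3, (hs ⟨_, h1⟩).base] at h4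
    exact lt_irrefl _ h4
  · obtain ⟨M, hM⟩ := (hS.finite.image L).bddAbove
    have hM' : ∀ s ∈ S, L s ≤ M := fun s hs => hM (Set.mem_image_of_mem _ hs)
    -- The extra 1 keeps the constant positive when C = 0. For trivial G the union is empty and the
    -- supremum is 0.
    refine ⟨C * (2 * M + 1) + 1, Nat.succ_pos _, fun n hn => ?_⟩
    refine (ciSup_le' fun p => ?_ : vol S (Σ g, X g) n ≤ C * ((2 * M + 1) * n)).trans ?_
    · obtain ⟨g, y⟩ := p
      have hsub : ((fun h : G => h • (⟨g, y⟩ : Σ g, X g)) '' wordBall S n) ⊆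
          Sigma.mk g '' {z | f g z ∈ Finset.Icc (f g y - n * M) (f g y + n * M)} := by
        rintro _ ⟨h, hh, rfl⟩
        refine ⟨ρ g h y, ?_, rfl⟩
        have h1 := apply_le_of_mem_wordBall hM' (hs g).lipschitz hh y
        have h2 := apply_le_of_mem_wordBall hM' (hs g).lipschitz
          (inv_mem_wordBall hS.symm hh) (ρ g h y)
        rw [← Perm.mul_apply, ← map_mul, inv_mul_cancel, map_one, Perm.one_apply] at h2
        simp only [Set.mem_ofPred_eq, Finset.mem_Icc]
        omega
      have hle := (Set.encard_le_encard hsub).trans ((Set.encard_image_le _ _).trans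
        (encard_le_of_fiber (hs g).fiber _))
      -- The window has at most 2nM + 1 heights; n ≥ 1 absorbs the 1 into a multiple of n.
      have hcard : (Finset.Icc (f g y - n * M) (f g y + n * M)).card ≤ (2 * M + 1) * n := by
        rw [Nat.card_Icc]
        have : (2 * M + 1) * n = 2 * (n * M) + n := by ring
        omega
      rw [Set.ncard]
      refine ENat.toNat_le_of_le_natCast (hle.trans ?_)
      exact_mod_cast Nat.mul_le_mul_left C hcard
    · have h1 : C * ((2 * M + 1) * n) = C * (2 * M + 1) * n := by ring
      rw [h1]
      set K := C * (2 * M + 1)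
      calc K * n ≤ (K + 1) * n := Nat.mul_le_mul_right _ (Nat.le_succ _)
        _ ≤ (K + 1) * ((K + 1) * n) :=
          Nat.mul_le_mul_left _ (Nat.le_mul_of_pos_left _ (Nat.succ_pos _))

/-! ## Maps to cyclic groups -/

theorem natAbs_valMinAbs_natCast {D : ℕ} (hD : 0 < D) :
    ((D : ZMod (2 * D)).valMinAbs).natAbs = D := by
  have : NeZero (2 * D) := ⟨by omega⟩
  rw [ZMod.valMinAbs_natAbs_eq_min, ZMod.val_natCast, Nat.mod_eq_of_lt (by omega)]
  omega

theorem natAbs_valMinAbs_intCast_le (n : ℕ) [NeZero n] (e : ℤ) :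
    ((e : ZMod n).valMinAbs).natAbs ≤ e.natAbs := by
  exact ZMod.natAbs_min_of_le_div_two n _ _ (ZMod.coe_valMinAbs _) (ZMod.natAbs_valMinAbs_le _)

/-- A map to a cyclic group of order `2 * D` which is Lipschitz, has bounded fibres, and sends
`x` and `g • x` to antipodal points, yields a separating function. -/
theorem separates_of_antipodal {G : Type u} [Group G] {C D : ℕ} (hD : 0 < D) {X : Type}
    (ρ : G →* Perm X) (π : X → ZMod (2 * D)) (hπ : ∀ c, {y | π y = c}.encard ≤ C) {x : X} {g : G}
    (hx : π (ρ g x) = π x + D) {T : Set G} {K : G → ℕ}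
    (hL : ∀ s ∈ T, ∀ y, ∃ e : ℤ, e.natAbs ≤ K s ∧ π (ρ s y) = π y + e) :
    ∃ f : X → ℕ, f x = 0 ∧ 0 < f (ρ g x) ∧ (∀ y, f y ≤ f (ρ g x)) ∧
      (∀ s ∈ T, ∀ y, f (ρ s y) ≤ f y + K s ∧ f y ≤ f (ρ s y) + K s) ∧
      ∀ k, {y | f y = k}.encard ≤ (2 * C : ℕ) := by
  have : NeZero (2 * D) := ⟨by omega⟩
  have htop : ((π (ρ g x) - π x).valMinAbs).natAbs = D := by
    rw [hx, add_sub_cancel_left, natAbs_valMinAbs_natCast hD]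
  have hadd : ∀ (a : ZMod (2 * D)) (e : ℤ),
      ((a + e).valMinAbs).natAbs ≤ a.valMinAbs.natAbs + e.natAbs := fun a e =>
    (ZMod.natAbs_valMinAbs_add_le a e).trans ((Int.natAbs_add_le _ _).trans
      (Nat.add_le_add_left (natAbs_valMinAbs_intCast_le _ e) _))
  -- The height is the distance to π x on the cycle of length 2D: at most D, attained at the
  -- antipode. Each height k comes from the two residues π x ± k, whence the factor 2.
  refine ⟨fun y => ((π y - π x).valMinAbs).natAbs, by simp, by simpa only [htop] using hD,
    fun y => ?_, fun s hs y => ?_, fun k => ?_⟩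
  · have := ZMod.natAbs_valMinAbs_le (π y - π x)
    simp only [htop]
    omega
  · obtain ⟨e, he, hy⟩ := hL s hs y
    have h1 := hadd (π y - π x) e
    have h2 := hadd (π y - π x + e) (-e)
    rw [Int.cast_neg, add_neg_cancel_right, Int.natAbs_neg] at h2
    simp only [hy, add_sub_right_comm]
    omega
  · have hsub : {y | ((π y - π x).valMinAbs).natAbs = k} ⊆
        {y | π y = π x + k} ∪ {y | π y = π x - k} := by
      rintro y rfl
      have h0 := ZMod.coe_valMinAbs (π y - π x)
      rcases Int.natAbs_eq (π y - π x).valMinAbs with h | h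
      · left
        rw [h] at h0
        simp only [Set.mem_ofPred_eq]
        rw [← Int.cast_natCast, h0]; ring
      · right
        rw [h] at h0
        simp only [Set.mem_ofPred_eq]
        rw [Int.cast_neg, Int.cast_natCast] at h0
        rw [sub_eq_add_neg, h0]; ring
    refine (Set.encard_le_encard hsub).trans ((Set.encard_union_le _ _).trans ?_)
    exact (add_le_add (hπ _) (hπ _)).trans (by rw [← Nat.cast_add, ← two_mul])

/-- A Lipschitz function with bounded fibres, whose range is comparable to the distance between its
values at `x` and `g • x`, can be folded into a separating function. -/
theorem separates_of_range {G : Type u} [Group G] {C D N : ℕ} (hD : 0 < D) {X : Type}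
    (ρ : G →* Perm X) (f : X → ℤ) (hf : ∀ c, {y | f y = c}.encard ≤ C) {x : X} {g : G}
    (hx : (f (ρ g x) - f x).natAbs = D) {a : ℤ} (ha : ∀ y, a ≤ f y) (hN : ∀ y, f y < a + N)
    (hND : N ≤ 8 * D) {T : Set G} {K : G → ℕ}
    (hL : ∀ s ∈ T, ∀ y, (f (ρ s y) - f y).natAbs ≤ K s) :
    ∃ f : X → ℕ, f x = 0 ∧ 0 < f (ρ g x) ∧ (∀ y, f y ≤ f (ρ g x)) ∧
      (∀ s ∈ T, ∀ y, f (ρ s y) ≤ f y + K s ∧ f y ≤ f (ρ s y) + K s) ∧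
      ∀ k, {y | f y = k}.encard ≤ (2 * (C * 4) : ℕ) := by
  have hper : ((2 * D : ℕ) : ZMod (2 * D)) = 0 := ZMod.natCast_self _
  refine separates_of_antipodal hD ρ (fun y => (f y : ZMod (2 * D))) (fun c => ?_) ?_
    fun s hs y => ⟨f (ρ s y) - f y, hL s hs y, by push_cast; ring⟩
  -- The range has length N ≤ 8D, so each residue class modulo 2D contains at most four values.
  · have hsub : {y | (f y : ZMod (2 * D)) = c} ⊆ {y | f y ∈ (Finset.range 4).image
        fun q : ℕ => a + 2 * D * q + (c - a : ZMod (2 * D)).cast % (2 * D)} := by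
      rintro y rfl
      have h1 := ha y
      have h2 := hN y
      have h3 := Int.mul_ediv_add_emod (f y - a) (2 * D)
      have h4 : ((f y - a : ZMod (2 * D)).cast : ℤ) % (2 * D) = (f y - a) % (2 * D) := by
        rw [← Int.cast_sub, ZMod.coe_intCast]
        push_cast
        rw [Int.emod_emod]
      simp only [Set.mem_ofPred_eq, Finset.mem_image, Finset.mem_range]
      refine ⟨((f y - a) / (2 * D)).toNat, ?_, ?_⟩
      · have : (f y - a) / (2 * D) < 4 := Int.ediv_lt_of_lt_mul (by omega) (by omega)
        omega
      · rw [h4, Int.toNat_of_nonneg (Int.ediv_nonneg (by omega) (by omega))]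
        linarith
    refine (Set.encard_le_encard hsub).trans ((encard_le_of_fiber hf _).trans ?_)
    exact_mod_cast Nat.mul_le_mul_left C (Finset.card_image_le.trans (by simp))
  -- The sign of the difference is irrelevant, since D = -D modulo 2D.
  · rcases Int.natAbs_eq (f (ρ g x) - f x) with h | h
    · rw [hx, sub_eq_iff_eq_add] at h
      simp only [h]
      push_cast
      ring
    · rw [hx, sub_eq_iff_eq_add] at h
      simp only [h]
      push_cast at hper ⊢
      linear_combination -hper

/-! ## Finite groups and abelian groups -/

theorem linSep_of_finite (G : Type u) [Group G] [Finite G] : LinSep (Nat.card G) G := by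
  classical
  let e := Finite.equivFin G
  -- The regular representation, transported to `Fin` so that the point set lies in `Type`.
  let ρ : G →* Perm (Fin (Nat.card G)) :=
    e.permCongrHom.toMonoidHom.comp (MulAction.toPermHom G G)
  refine ⟨fun _ => 1, fun g hg => ⟨Fin (Nat.card G), ρ, fun y => if y = e 1 then 0 else 1,
    e 1, ?_⟩⟩
  have hρ : ρ g (e 1) = e g := by
    simp [ρ, Equiv.permCongrHom]
  have hne : e g ≠ e 1 := fun h => hg (e.injective h)
  refine ⟨if_pos rfl, ?_, fun y => ?_, fun s y => ?_, fun k => ?_⟩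
  · rw [hρ, if_neg hne]; exact one_pos
  · rw [hρ, if_neg hne]; split_ifs <;> omega
  · split_ifs <;> omega
  · exact (Set.encard_le_card).trans (by simp)

theorem linSep_int : LinSep 2 (Multiplicative ℤ) := by
  refine LinSep.of_closure (T := Set.univ) (Subgroup.closure_univ)
    (fun s => (Multiplicative.toAdd s).natAbs) fun g hg => ?_
  set n := Multiplicative.toAdd g with hn
  have hn0 : n ≠ 0 := fun h => hg (Multiplicative.toAdd.injective h)
  have hD : 0 < n.natAbs := Int.natAbs_pos.2 hn0
  let ρ : Multiplicative ℤ →* Perm (ZMod (2 * n.natAbs)) :=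
    { toFun := fun s => Equiv.addRight ((Multiplicative.toAdd s : ℤ) : ZMod (2 * n.natAbs))
      map_one' := by ext; simp
      map_mul' := fun a b => by ext y; simp [add_assoc, add_comm (Int.cast (Multiplicative.toAdd a) : ZMod _)] }
  have hρ : ∀ s y, ρ s y = y + ((Multiplicative.toAdd s : ℤ) : ZMod (2 * n.natAbs)) :=
    fun _ _ => rfl
  refine ⟨_, ρ, ?_⟩
  obtain ⟨f, hf⟩ := separates_of_antipodal (C := 1) (x := 0) (g := g) (T := Set.univ)
    (K := fun s => (Multiplicative.toAdd s).natAbs) hD ρ id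
    (fun c => by simp) (by
      have hper : ((2 * n.natAbs : ℕ) : ZMod (2 * n.natAbs)) = 0 := ZMod.natCast_self _
      rw [hρ, ← hn]
      simp only [id]
      rcases Int.natAbs_eq n with h | h
      · have h' : ((n : ℤ) : ZMod (2 * n.natAbs)) = (n.natAbs : ZMod (2 * n.natAbs)) := by
          rw [← Int.cast_natCast, ← h]
        rw [h']
      · have h' : ((n : ℤ) : ZMod (2 * n.natAbs)) = -(n.natAbs : ZMod (2 * n.natAbs)) := by
          rw [← Int.cast_natCast, ← Int.cast_neg, ← h]
        rw [h']
        push_cast at hper ⊢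
        linear_combination -hper)
    fun s _ y => ⟨Multiplicative.toAdd s, le_rfl, hρ s y⟩
  exact ⟨f, 0, hf⟩

theorem LinSep.prod {G : Type u} [Group G] {H : Type v} [Group H] {C : ℕ} (hG : LinSep C G)
    (hH : LinSep C H) : LinSep C (G × H) := by
  obtain ⟨L, hL⟩ := hG
  obtain ⟨M, hM⟩ := hH
  refine ⟨fun s => L s.1 + M s.2, fun g hg => ?_⟩
  by_cases h : g.1 = 1
  · obtain ⟨X, ρ, f, x, hs⟩ := hM g.2 fun h' => hg (Prod.ext h h')
    exact ⟨X, ρ.comp (MonoidHom.snd G H), f, x,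
      (hs.comp (MonoidHom.snd G H)).mono le_rfl fun _ => Nat.le_add_left _ _⟩
  · obtain ⟨X, ρ, f, x, hs⟩ := hL g.1 h
    exact ⟨X, ρ.comp (MonoidHom.fst G H), f, x,
      (hs.comp (MonoidHom.fst G H)).mono le_rfl fun _ => Nat.le_add_right _ _⟩

theorem linSep_of_comm (G : Type u) [Group G] (hG : Group.FG G) (hc : ∀ a b : G, a * b = b * a) :
    ∃ C, LinSep C G := by
  let _ : CommGroup G := { ‹Group G› with mul_comm := hc }
  have : Group.FG G := hG
  obtain ⟨κ, j, _, _, p, hp, e, ⟨φ⟩⟩ := CommGroup.equiv_free_prod_prod_multiplicative_zmod G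
  have : ∀ i, NeZero (p i ^ e i) := fun i => ⟨pow_ne_zero _ (hp i).ne_zero⟩
  have : ∀ i, Finite (Multiplicative (ZMod (p i ^ e i))) := fun i =>
    inferInstanceAs (Finite (ZMod (p i ^ e i)))
  have hZ : LinSep 2 (j → Multiplicative ℤ) :=
    LinSep.of_separating (fun _ : j => linSep_int) (fun k => Pi.evalMonoidHom _ k)
      fun g hg => Function.ne_iff.1 hg
  exact ⟨_, ((hZ.mono (le_max_left _ _)).prod ((linSep_of_finite _).mono
    (le_max_right _ _))).of_injective φ.toMonoidHom φ.injective⟩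

/-! ## Words in graph products -/

section GraphProduct

variable {ι : Type w} {Γ : SimpleGraph ι} {G : ι → Type u} [∀ i, Group (G i)]

/-- The canonical map from a vertex group to the graph product. -/
def ofVertex (Γ : SimpleGraph ι) (i : ι) : G i →* GraphProduct Γ G :=
  (QuotientGroup.mk' (Subgroup.normalClosure (graphProductRels Γ G))).comp Monoid.CoprodI.of

theorem ofVertex_commute {i j : ι} (hij : Γ.Adj i j) (g : G i) (h : G j) :
    Commute (ofVertex Γ i g) (ofVertex Γ j h) := by
  have hmem : Monoid.CoprodI.of g * Monoid.CoprodI.of h * (Monoid.CoprodI.of g)⁻¹ *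
      (Monoid.CoprodI.of h)⁻¹ ∈ Subgroup.normalClosure (graphProductRels Γ G) :=
    Subgroup.subset_normalClosure ⟨i, j, hij, g, h, rfl⟩
  have h1 : ofVertex Γ i g * ofVertex Γ j h * (ofVertex Γ i g)⁻¹ * (ofVertex Γ j h)⁻¹ = 1 :=
    (QuotientGroup.eq_one_iff _).2 hmem
  exact mul_inv_eq_iff_eq_mul.1 (mul_inv_eq_one.1 h1)

/-- The universal property of the graph product. -/
def liftVertex {H : Type v} [Group H] (φ : ∀ i, G i →* H)
    (hφ : ∀ i j, Γ.Adj i j → ∀ g h, Commute (φ i g) (φ j h)) : GraphProduct Γ G →* H :=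
  QuotientGroup.lift _ (Monoid.CoprodI.lift φ) <| Subgroup.normalClosure_le_normal <| by
    rintro _ ⟨i, j, hij, g, h, rfl⟩
    simp only [SetLike.mem_coe, MonoidHom.mem_ker, map_mul, map_inv, Monoid.CoprodI.lift_of]
    rw [(hφ i j hij g h).eq, mul_inv_cancel_right, mul_inv_cancel]

theorem liftVertex_ofVertex {H : Type v} [Group H] (φ : ∀ i, G i →* H)
    (hφ : ∀ i j, Γ.Adj i j → ∀ g h, Commute (φ i g) (φ j h)) (i : ι) (g : G i) :
    liftVertex φ hφ (ofVertex Γ i g) = φ i g :=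
  Monoid.CoprodI.lift_of φ g

/-- The element of the graph product represented by a word. -/
def wordProd (Γ : SimpleGraph ι) (l : List (Σ i, G i)) : GraphProduct Γ G :=
  (l.map fun s => ofVertex Γ s.1 s.2).prod

@[simp]
theorem wordProd_nil : wordProd Γ ([] : List (Σ i, G i)) = 1 := rfl

@[simp]
theorem wordProd_cons (s : Σ i, G i) (l : List (Σ i, G i)) :
    wordProd Γ (s :: l) = ofVertex Γ s.1 s.2 * wordProd Γ l := by
  simp [wordProd]

@[simp]
theorem wordProd_append (l l' : List (Σ i, G i)) :
    wordProd Γ (l ++ l') = wordProd Γ l * wordProd Γ l' := by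
  simp [wordProd]

theorem exists_wordProd_eq (w : GraphProduct Γ G) : ∃ l, wordProd Γ l = w := by
  obtain ⟨w, rfl⟩ := QuotientGroup.mk'_surjective _ w
  induction w using Monoid.CoprodI.induction_on with
  | one => exact ⟨[], (map_one _).symm⟩
  | of i g => exact ⟨[⟨i, g⟩], by rw [wordProd_cons, wordProd_nil, mul_one]; rfl⟩
  | mul x y hx hy =>
    obtain ⟨l, hl⟩ := hx
    obtain ⟨l', hl'⟩ := hy
    exact ⟨l ++ l', by rw [wordProd_append, hl, hl', map_mul]⟩

theorem closure_iUnion_range_ofVertex :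
    Subgroup.closure (⋃ i, Set.range (ofVertex Γ i : G i →* GraphProduct Γ G)) = ⊤ := by
  refine (Subgroup.eq_top_iff' _).2 fun w => ?_
  obtain ⟨l, rfl⟩ := exists_wordProd_eq w
  refine Subgroup.list_prod_mem _ fun x hx => ?_
  obtain ⟨s, _, rfl⟩ := List.mem_map.1 hx
  exact Subgroup.subset_closure (Set.mem_iUnion.2 ⟨s.1, s.2, rfl⟩)

/-- A word of minimal length among those representing the same element. -/
def IsGeodesicWord (Γ : SimpleGraph ι) (l : List (Σ i, G i)) : Prop :=
  ∀ l', wordProd Γ l' = wordProd Γ l → l.length ≤ l'.length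

theorem exists_isGeodesicWord (w : GraphProduct Γ G) :
    ∃ l, wordProd Γ l = w ∧ IsGeodesicWord Γ l := by
  classical
  have hex : ∃ n, ∃ l, wordProd Γ l = w ∧ l.length = n :=
    (exists_wordProd_eq w).imp' _ fun l hl => ⟨l, hl, rfl⟩
  obtain ⟨l, hl, hn⟩ := Nat.find_spec hex
  exact ⟨l, hl, fun l' hl' => hn ▸ Nat.find_min' hex ⟨l', hl'.trans hl, rfl⟩⟩

theorem IsGeodesicWord.tail {s : Σ i, G i} {l : List (Σ i, G i)}
    (h : IsGeodesicWord Γ (s :: l)) : IsGeodesicWord Γ l := fun l' hl' => by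
  simpa using h (s :: l') (by simp [hl'])

theorem IsGeodesicWord.ne_one {i : ι} {g : G i} {l : List (Σ i, G i)}
    (h : IsGeodesicWord Γ (⟨i, g⟩ :: l)) : g ≠ 1 := by
  rintro rfl
  simpa using h l (by simp)

theorem wordProd_commute {i : ι} (g : G i) {l : List (Σ i, G i)} (hl : ∀ s ∈ l, Γ.Adj s.1 i) :
    Commute (ofVertex Γ i g) (wordProd Γ l) := by
  refine Commute.list_prod_right _ _ fun x hx => ?_
  obtain ⟨s, hs, rfl⟩ := List.mem_map.1 hx
  exact ofVertex_commute (hl s hs).symm _ _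

/-- In a geodesic word two letters of the same vertex group are never separated only by letters of
adjacent vertex groups. -/
theorem IsGeodesicWord.ne_of_commute {i j : ι} {g : G i} {h : G j} {l l' : List (Σ i, G i)}
    (hl : ∀ s ∈ l, Γ.Adj s.1 j) (hw : IsGeodesicWord Γ (⟨i, g⟩ :: (l ++ ⟨j, h⟩ :: l'))) :
    i ≠ j := by
  rintro rfl
  -- Moving g past l and merging it with h gives a word shorter by one letter.
  have := hw (l ++ ⟨i, g * h⟩ :: l') (by
    simp only [wordProd_cons, wordProd_append, map_mul]
    have := (wordProd_commute g hl).eq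
    simp only [← mul_assoc, this])
  simp at this

end GraphProduct

/-! ## Wedges of actions -/

section Wedge

open scoped Classical

variable {X Y : Type}

/-- Permutations of `Y` act on `Y ⊕ X`. -/
def wedgeLeft (X : Type) : Perm Y →* Perm (Y ⊕ X) :=
  (Perm.sumCongrHom Y X).comp (MonoidHom.inl _ _)

/-- Permutations of `X` act on the wedge of `Y` and `X` at the points `y` and `x`. The wedge is
realized in `Y ⊕ X`, with `inl y` as wedge point and `inr x` as an additional fixed point. -/
noncomputable def wedgeRight (y : Y) (x : X) : Perm X →* Perm (Y ⊕ X) :=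
  (MulAut.conj (swap (Sum.inl y) (Sum.inr x))).toMonoidHom.comp
    ((Perm.sumCongrHom Y X).comp (MonoidHom.inr _ _))

@[simp]
theorem wedgeLeft_inl (p : Perm Y) (z : Y) : wedgeLeft X p (Sum.inl z) = Sum.inl (p z) := rfl

@[simp]
theorem wedgeLeft_inr (p : Perm Y) (z : X) : wedgeLeft X p (Sum.inr z) = Sum.inr z := rfl

theorem wedgeRight_apply (y : Y) (x : X) (q : Perm X) (z : Y ⊕ X) :
    wedgeRight y x q z = swap (Sum.inl y) (Sum.inr x)
      (Sum.map id q (swap (Sum.inl y) (Sum.inr x) z)) := by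
  simp only [wedgeRight, MonoidHom.comp_apply, MulEquiv.coe_toMonoidHom, MulAut.conj_apply,
    swap_inv, Perm.mul_apply]
  rfl

theorem wedgeRight_inl_of_ne {y z : Y} (x : X) (q : Perm X) (hz : z ≠ y) :
    wedgeRight y x q (Sum.inl z) = Sum.inl z := by
  have h : swap (Sum.inl y) (Sum.inr x) (Sum.inl z) = (Sum.inl z : Y ⊕ X) :=
    swap_apply_of_ne_of_ne (by simpa using hz) (by simp)
  rw [wedgeRight_apply, h, Sum.map_inl, id, h]

theorem wedgeRight_inl_self (y : Y) (x : X) (q : Perm X) :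
    wedgeRight y x q (Sum.inl y) = if q x = x then Sum.inl y else Sum.inr (q x) := by
  rw [wedgeRight_apply, swap_apply_left, Sum.map_inr]
  split_ifs with h
  · rw [h, swap_apply_right]
  · exact swap_apply_of_ne_of_ne (by simp) (by simpa using h)

theorem wedgeRight_inr_self (y : Y) (x : X) (q : Perm X) :
    wedgeRight y x q (Sum.inr x) = Sum.inr x := by
  rw [wedgeRight_apply, swap_apply_right, Sum.map_inl, id, swap_apply_left]

theorem wedgeRight_inr_of_ne (y : Y) {x z : X} (q : Perm X) (hz : z ≠ x) :
    wedgeRight y x q (Sum.inr z) = if q z = x then Sum.inl y else Sum.inr (q z) := by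
  have hz' : swap (Sum.inl y) (Sum.inr x) (Sum.inr z) = (Sum.inr z : Y ⊕ X) :=
    swap_apply_of_ne_of_ne (by simp) (by simpa using hz)
  rw [wedgeRight_apply, hz', Sum.map_inr]
  split_ifs with h
  · rw [h, swap_apply_right]
  · exact swap_apply_of_ne_of_ne (by simp) (by simpa using h)

/-- The supports are disjoint: one permutation moves only points of Y other than y, the other only
the wedge point and points of X. -/
theorem wedgeLeft_commute_wedgeRight {y : Y} (x : X) {p : Perm Y} (q : Perm X) (hp : p y = y) :
    Commute (wedgeLeft X p) (wedgeRight y x q) := by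
  have h1 : Commute (wedgeLeft X p) (swap (Sum.inl y) (Sum.inr x)) := by
    rw [commute_iff_eq, mul_swap_eq_swap_mul, wedgeLeft_inl, wedgeLeft_inr, hp]
  have h2 : Commute (wedgeLeft X p) (Perm.sumCongrHom Y X (1, q)) := by
    simp [wedgeLeft, commute_iff_eq]
  exact (h1.mul_right h2).mul_right h1.inv_right

/-- The action of a group on a wedge. -/
noncomputable def wedgeHom {H : Type u} [Group H] (y : Y) (x : X) (ρ : H →* Perm Y) (σ : H →* Perm X)
    (h : σ = 1 ∨ ∀ g, ρ g y = y) : H →* Perm (Y ⊕ X) where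
  toFun g := wedgeLeft X (ρ g) * wedgeRight y x (σ g)
  map_one' := by simp
  map_mul' a b := by
    have : Commute (wedgeLeft X (ρ b)) (wedgeRight y x (σ a)) := by
      rcases h with rfl | h
      · simp
      · exact wedgeLeft_commute_wedgeRight _ _ (h b)
    simp only [map_mul, mul_assoc]
    rw [← mul_assoc (wedgeRight y x (σ a)), ← this.eq, mul_assoc]

theorem wedgeHom_apply {H : Type u} [Group H] (y : Y) (x : X) (ρ : H →* Perm Y) (σ : H →* Perm X)
    (h : σ = 1 ∨ ∀ g, ρ g y = y) (g : H) :
    wedgeHom y x ρ σ h g = wedgeLeft X (ρ g) * wedgeRight y x (σ g) := rfl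

theorem wedgeHom_commute {H H' : Type u} [Group H] [Group H'] (y : Y) (x : X) {ρ : H →* Perm Y}
    {σ : H →* Perm X} (h : σ = 1 ∨ ∀ g, ρ g y = y) {ρ' : H' →* Perm Y}
    {σ' : H' →* Perm X} (h' : σ' = 1 ∨ ∀ g, ρ' g y = y) (hσ : σ = 1 ∨ σ' = 1)
    (h1 : σ = 1 ∨ ∀ g, ρ' g y = y) (h2 : σ' = 1 ∨ ∀ g, ρ g y = y) {a : H} {b : H'}
    (hab : Commute (ρ a) (ρ' b)) :
    Commute (wedgeHom y x ρ σ h a) (wedgeHom y x ρ' σ' h' b) := by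
  rw [wedgeHom_apply, wedgeHom_apply]
  refine ((hab.map _).mul_right ?_).mul_left (Commute.mul_right ?_ ?_)
  · rcases h2 with rfl | h2
    · simp
    · exact wedgeLeft_commute_wedgeRight _ _ (h2 a)
  · rcases h1 with rfl | h1
    · simp
    · exact (wedgeLeft_commute_wedgeRight _ _ (h1 b)).symm
  · rcases hσ with rfl | rfl <;> simp

end Wedge

/-! ## Chains -/

section Chain

variable {ι : Type w} {Γ : SimpleGraph ι} {G : ι → Type u} [∀ i, Group (G i)]

/-- A chain of pieces, each with an action of a vertex group, along which the word `l` moves the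
initial point `x` to the final point `y`. The vertex of the last piece is `m`. -/
structure IsChain (Γ : SimpleGraph ι) (C : ℕ) (L : ∀ i, G i → ℕ) (l : List (Σ i, G i))
    (m : Option ι) {Y : Type} (ρ : GraphProduct Γ G →* Perm Y) (f : Y → ℕ) (x y : Y) : Prop where
  base : f x = 0
  le : ∀ z, f z ≤ f y
  lipschitz : ∀ i g z, f (ρ (ofVertex Γ i g) z) ≤ f z + L i g
  fiber : ∀ k, {z | f z = k}.encard ≤ (2 * C : ℕ)
  -- The next piece meets the old heights only at the top one, so the bound C there keeps the total
  -- at 2C.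
  fiber_top : {z | f z = f y}.encard ≤ C
  fixes : ∀ i, m ≠ some i → ∀ g, ρ (ofVertex Γ i g) y = y
  apply : ρ (wordProd Γ l) x = y
  -- Once the trajectory has reached y, only letters adjacent to the last vertex follow. A new piece
  -- at y, of a vertex not adjacent to the last one, therefore does not divert the trajectory.
  path : ∀ s l', s :: l' <:+ l → ρ (wordProd Γ l') x = y → ∃ j ∈ m, Γ.Adj s.1 j
  pos : ∀ j ∈ m, 0 < f y
  -- This form is what geodesicity excludes for a further letter of the same vertex j.
  last : ∀ j ∈ m, ∃ l₁ h l₂, l = l₁ ++ ⟨j, h⟩ :: l₂ ∧ ∀ s ∈ l₁, Γ.Adj s.1 j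
  nil : m = none → l = []

theorem IsChain.trivial {C : ℕ} (hC : 1 ≤ C) (L : ∀ i, G i → ℕ) :
    IsChain Γ C L [] none 1 (fun _ : Unit => 0) () () where
  base := rfl
  le _ := le_rfl
  lipschitz _ _ _ := Nat.zero_le _
  fiber k := Set.encard_le_card.trans (by simp; norm_cast; omega)
  fiber_top := Set.encard_le_card.trans (by simpa using hC)
  fixes _ _ _ := rfl
  apply := rfl
  path s l' h := by simp at h
  pos := by simp
  last := by simp
  nil _ := rfl

/-- A letter of a vertex adjacent to the vertex of the last piece fixes the final point. -/
theorem IsChain.cons_of_adj {C : ℕ} {L : ∀ i, G i → ℕ} {l : List (Σ i, G i)} {m : ι} {Y : Type}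
    {ρ : GraphProduct Γ G →* Perm Y} {f : Y → ℕ} {x y : Y}
    (h : IsChain Γ C L l (some m) ρ f x y) {i : ι} (him : Γ.Adj i m) (g : G i) :
    IsChain Γ C L (⟨i, g⟩ :: l) (some m) ρ f x y :=
  { h with
    apply := by
      rw [wordProd_cons, map_mul, Perm.mul_apply, h.apply]
      exact h.fixes i (fun h' => him.ne (Option.some.inj h').symm) g
    path := fun s l' hs hy => by
      rcases List.suffix_cons_iff.1 hs with hs | hs
      · obtain ⟨rfl, rfl⟩ := List.cons.inj hs
        exact ⟨m, rfl, him⟩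
      · exact h.path s l' hs hy
    last := fun j hj => by
      obtain rfl : m = j := Option.some.inj hj
      obtain ⟨l₁, k, l₂, rfl, h₁⟩ := h.last m rfl
      refine ⟨⟨i, g⟩ :: l₁, k, l₂, rfl, ?_⟩
      simpa using ⟨him, h₁⟩
    nil := fun h' => by simp at h' }

open scoped Classical in
/-- A letter of a vertex not adjacent to the vertex of the last piece adds a piece. -/
theorem IsChain.exists_cons {C : ℕ} {L : ∀ i, G i → ℕ} {l : List (Σ i, G i)} {m : Option ι}
    {Y : Type} {ρ : GraphProduct Γ G →* Perm Y} {f : Y → ℕ} {x y : Y}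
    (hY : IsChain Γ C L l m ρ f x y) {i : ι} (him : ∀ j ∈ m, i ≠ j ∧ ¬Γ.Adj i j) {g : G i}
    {X : Type} {σ : G i →* Perm X} {e : X → ℕ} {z : X} (hX : Separates C (L i) g σ e z) :
    ∃ (Y' : Type) (ρ' : GraphProduct Γ G →* Perm Y') (f' : Y' → ℕ) (x' y' : Y'),
      IsChain Γ C L (⟨i, g⟩ :: l) (some i) ρ' f' x' y' := by
  -- Only G_i acts on the new piece; the other vertex groups act trivially there.
  let σ' : ∀ j, G j →* Perm X := Function.update 1 i σ
  have hσi : σ' i = σ := Function.update_self ..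
  have hσ : ∀ j, j ≠ i → σ' j = 1 := fun j hj => Function.update_of_ne hj ..
  have hfix : ∀ g, ρ (ofVertex Γ i g) y = y :=
    hY.fixes i fun h => (him i h).1 rfl
  -- A neighbour j of i is not the last vertex, so G_j fixes the gluing point. This gives the
  -- commutation relations on the wedge.
  have hfix' : ∀ j, Γ.Adj i j → ∀ g, ρ (ofVertex Γ j g) y = y := fun j hj =>
    hY.fixes j fun h => (him j h).2 hj
  have hw : ∀ j, σ' j = 1 ∨ ∀ g, (ρ.comp (ofVertex Γ j)) g y = y := fun j => by
    by_cases hj : j = i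
    · subst hj; exact Or.inr hfix
    · exact Or.inl (hσ j hj)
  let ρ' : GraphProduct Γ G →* Perm (Y ⊕ X) :=
    liftVertex (fun j => wedgeHom y z (ρ.comp (ofVertex Γ j)) (σ' j) (hw j))
      fun j k hjk a b => by
        have aux : ∀ j k, Γ.Adj j k → σ' j = 1 ∨ ∀ g, (ρ.comp (ofVertex Γ k)) g y = y :=
          fun j k hjk => by
            by_cases hj : j = i
            · subst hj; exact Or.inr (hfix' k hjk)
            · exact Or.inl (hσ j hj)
        refine wedgeHom_commute y z _ _ ?_ (aux j k hjk) (aux k j hjk.symm)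
          ((ofVertex_commute hjk a b).map ρ)
        by_cases hj : j = i
        · exact Or.inr (hσ k fun hk => hjk.ne (hj.trans hk.symm))
        · exact Or.inl (hσ j hj)
  have hρ' : ∀ j a p, ρ' (ofVertex Γ j a) p =
      wedgeLeft X (ρ (ofVertex Γ j a)) (wedgeRight y z (σ' j a) p) := fun j a p => by
    simp only [ρ', liftVertex_ofVertex, wedgeHom_apply]
    rfl
  have hne : ∀ j, j ≠ i → ∀ a p,
      ρ' (ofVertex Γ j a) p = wedgeLeft X (ρ (ofVertex Γ j a)) p := fun j hj a p => by
    rw [hρ', hσ j hj]; simp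
  have hinl : ∀ j a u, (u = y → j ≠ i) →
      ρ' (ofVertex Γ j a) (Sum.inl u) = Sum.inl (ρ (ofVertex Γ j a) u) := fun j a u hu => by
    by_cases hj : j = i
    · rw [hρ', wedgeRight_inl_of_ne _ _ fun h => hu h hj, wedgeLeft_inl]
    · rw [hne j hj, wedgeLeft_inl]
  have hinl' : ∀ a, ρ' (ofVertex Γ i a) (Sum.inl y) =
      if σ a z = z then Sum.inl y else Sum.inr (σ a z) := fun a => by
    rw [hρ', hσi, wedgeRight_inl_self]
    split_ifs
    · rw [wedgeLeft_inl, hfix]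
    · rfl
  have hinr : ∀ a, ρ' (ofVertex Γ i a) (Sum.inr z) = Sum.inr z := fun a => by
    rw [hρ', wedgeRight_inr_self, wedgeLeft_inr]
  have hinr' : ∀ a u, u ≠ z → ρ' (ofVertex Γ i a) (Sum.inr u) =
      if σ a u = z then Sum.inl y else Sum.inr (σ a u) := fun a u hu => by
    rw [hρ', hσi, wedgeRight_inr_of_ne _ _ hu]
    split_ifs
    · rw [wedgeLeft_inl, hfix]
    · rfl
  have hgz : σ g z ≠ z := fun h => by
    have := hX.pos
    rw [h, hX.base] at this
    exact lt_irrefl _ this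
  have hpath : ∀ l', l' <:+ l → ρ' (wordProd Γ l') (Sum.inl x) =
      Sum.inl (ρ (wordProd Γ l') x) := fun l' => by
    induction l' with
    | nil => simp
    | cons s l' ih =>
      intro hs
      rw [wordProd_cons, map_mul, map_mul, Perm.mul_apply, Perm.mul_apply,
        ih ((List.suffix_cons s l').trans hs), hinl]
      -- The new piece could interfere only if a letter of G_i were applied at y, but by `path` that
      -- letter would be adjacent to the last vertex.
      rintro hy hsi
      obtain ⟨j, hj, hadj⟩ := hY.path s l' hs hy
      exact (him j hj).2 (hsi ▸ hadj)
  -- The new piece is stacked on top of the old ones. The spare fixed point `inr z` has the height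
  -- of the junction.
  let f' : Y ⊕ X → ℕ := Sum.elim f fun u => f y + e u
  have hfib : ∀ k, {p | f' p = k} ⊆ Sum.inl '' {u | f u = k} ∪ Sum.inr '' {u | f y + e u = k} := by
    rintro k (u | u) hu
    · exact Or.inl ⟨u, hu, rfl⟩
    · exact Or.inr ⟨u, hu, rfl⟩
  have hfib' : ∀ k, {u | f y + e u = k}.encard ≤ C := fun k => by
    refine (Set.encard_le_encard fun u hu => ?_).trans (hX.fiber (k - f y))
    simp only [Set.mem_ofPred_eq] at hu ⊢
    omega
  have hfibr : ∀ k, (Sum.inr '' {u | f y + e u = k} : Set (Y ⊕ X)).encard ≤ C := fun k =>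
    (Set.encard_image_le _ _).trans (hfib' k)
  have hlow : ∀ k, k < f y → {u | f y + e u = k} = ∅ := fun k hk => by
    ext u; simp; omega
  have hhigh : ∀ k, f y < k → {u | f u = k} = ∅ := fun k hk => by
    ext u; have := hY.le u; simp; omega
  refine ⟨Y ⊕ X, ρ', f', Sum.inl x, Sum.inr (σ g z), ?_⟩
  constructor
  · exact hY.base
  · rintro (u | u)
    · exact (hY.le u).trans (Nat.le_add_right _ _)
    · exact Nat.add_le_add_left (hX.le u) _
  · intro j a p
    by_cases hj : j = i
    · subst hj
      rcases p with u | u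
      · by_cases hu : u = y
        · subst hu
          rw [hinl']
          split_ifs
          · exact Nat.le_add_right _ _
          · have := hX.lipschitz a z
            rw [hX.base] at this
            simp only [f', Sum.elim_inl, Sum.elim_inr]
            omega
        · rw [hinl _ _ _ fun h => (hu h).elim]
          exact hY.lipschitz j a u
      · by_cases hu : u = z
        · subst hu
          rw [hinr]
          exact Nat.le_add_right _ _
        · rw [hinr' _ _ hu]
          have := hX.lipschitz a u
          split_ifs <;> simp only [f', Sum.elim_inl, Sum.elim_inr] <;> omega
    · rw [hne j hj]
      rcases p with u | u
      · exact hY.lipschitz j a u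
      · exact Nat.le_add_right _ _
  · intro k
    refine (Set.encard_le_encard (hfib k)).trans ((Set.encard_union_le _ _).trans ?_)
    rcases lt_trichotomy k (f y) with hk | rfl | hk
    · rw [hlow k hk, Set.image_empty, Set.encard_empty, add_zero]
      exact (Set.encard_image_le _ _).trans (hY.fiber k)
    · rw [two_mul, Nat.cast_add]
      exact add_le_add ((Set.encard_image_le _ _).trans hY.fiber_top) (hfibr _)
    · rw [hhigh k hk, Set.image_empty, Set.encard_empty, zero_add]
      exact (hfibr k).trans (by norm_cast; omega)
  · have hk : f y < f' (Sum.inr (σ g z)) := Nat.lt_add_of_pos_right hX.pos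
    refine (Set.encard_le_encard (hfib _)).trans ((Set.encard_union_le _ _).trans ?_)
    rw [hhigh _ hk, Set.image_empty, Set.encard_empty, zero_add]
    exact hfibr _
  · intro j hj a
    rw [hne j fun h => hj (h ▸ rfl)]
    rfl
  · rw [wordProd_cons, map_mul, Perm.mul_apply, hpath l List.suffix_rfl, hY.apply, hinl',
      if_neg hgz]
  · intro s l' hs hy
    have hl' : l' <:+ l := by
      rcases List.suffix_cons_iff.1 hs with hs | hs
      · exact (List.cons.inj hs).2 ▸ List.suffix_rfl
      · exact (List.suffix_cons s l').trans hs
    rw [hpath l' hl'] at hy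
    simp at hy
  · intro j _
    exact Nat.add_pos_right _ hX.pos
  · intro j hj
    obtain rfl : i = j := Option.some.inj hj
    exact ⟨[], g, l, rfl, by simp⟩
  · simp

/-- Geodesicity enters twice: each letter is nontrivial, so it has a separating set, and a letter
not adjacent to the last vertex also differs from it, since otherwise two letters could be merged.
-/
theorem exists_isChain {C : ℕ} (hC : 1 ≤ C) {L : ∀ i, G i → ℕ}
    (hL : ∀ i, ∀ g : G i, g ≠ 1 → ∃ (X : Type) (ρ : G i →* Perm X) (f : X → ℕ) (x : X),
      Separates C (L i) g ρ f x) (l : List (Σ i, G i)) (hl : IsGeodesicWord Γ l) :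
    ∃ (m : Option ι) (Y : Type) (ρ : GraphProduct Γ G →* Perm Y) (f : Y → ℕ) (x y : Y),
      IsChain Γ C L l m ρ f x y := by
  induction l with
  | nil => exact ⟨_, _, _, _, _, _, IsChain.trivial hC L⟩
  | cons s l ih =>
    obtain ⟨i, g⟩ := s
    obtain ⟨m, Y, ρ, f, x, y, h⟩ := ih hl.tail
    by_cases hm : ∃ j ∈ m, Γ.Adj i j
    · obtain ⟨j, rfl, hj⟩ := hm
      exact ⟨_, Y, ρ, f, x, y, h.cons_of_adj hj g⟩
    · push Not at hm
      obtain ⟨X, σ, e, z, hX⟩ := hL i g hl.ne_one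
      refine ⟨_, h.exists_cons (fun j hj => ⟨?_, hm j hj⟩) hX⟩
      obtain ⟨l₁, k, l₂, rfl, h₁⟩ := h.last j hj
      exact hl.ne_of_commute h₁

/-- The graph product of a family of uniformly linearly separated groups is linearly separated. -/
theorem LinSep.graphProduct {C : ℕ} (Γ : SimpleGraph ι) (hG : ∀ i, LinSep C (G i)) :
    LinSep (2 * (C + 1)) (GraphProduct Γ G) := by
  choose L hL using hG
  -- The bound C + 1 is used because the one-point chain already needs a fibre bound of at least 1.
  have hL' : ∀ i, ∀ g : G i, g ≠ 1 → ∃ (X : Type) (ρ : G i →* Perm X) (f : X → ℕ) (x : X),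
      Separates (C + 1) (L i) g ρ f x := fun i g hg => by
    obtain ⟨X, ρ, f, x, h⟩ := hL i g hg
    exact ⟨X, ρ, f, x, h.mono (Nat.le_succ C) fun _ => le_rfl⟩
  -- Letters range over whole vertex groups, which are closed under inversion, so a one-sided bound
  -- on letters suffices.
  have hK : ∀ s : GraphProduct Γ G, ∃ K : ℕ, ∀ (Y : Type) (ρ : GraphProduct Γ G →* Perm Y)
      (f : Y → ℕ), (∀ i g z, f (ρ (ofVertex Γ i g) z) ≤ f z + L i g) →
        ∀ z, f (ρ s z) ≤ f z + K := fun s => by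
    obtain ⟨l, rfl⟩ := exists_wordProd_eq s
    induction l with
    | nil => exact ⟨0, fun Y ρ f _ z => by simp⟩
    | cons s l ih =>
      obtain ⟨K, hK⟩ := ih
      refine ⟨K + L s.1 s.2, fun Y ρ f hf z => ?_⟩
      have h1 := hK Y ρ f hf z
      have h2 := hf s.1 s.2 (ρ (wordProd Γ l) z)
      rw [wordProd_cons, map_mul, Perm.mul_apply]
      omega
  choose K hK using hK
  refine ⟨K, fun w hw => ?_⟩
  obtain ⟨l, rfl, hl⟩ := exists_isGeodesicWord w
  obtain ⟨m, Y, ρ, f, x, y, h⟩ := exists_isChain (Nat.le_add_left 1 C) hL' l hl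
  refine ⟨Y, ρ, f, x, h.base, ?_, ?_, fun s z => hK s Y ρ f h.lipschitz z, h.fiber⟩
  · rw [h.apply]
    rcases m with _ | m
    · exact (hw (by rw [h.nil rfl, wordProd_nil])).elim
    · exact h.pos m rfl
  · rw [h.apply]
    exact h.le

/-! ## Finite generation and free products -/

theorem fg_graphProduct [Finite ι] (Γ : SimpleGraph ι) (hG : ∀ i, Group.FG (G i)) :
    Group.FG (GraphProduct Γ G) := by
  choose S hS hfin using fun i => (Group.fg_iff (G := G i)).1 (hG i)
  refine Group.fg_iff.2 ⟨⋃ i, ofVertex Γ i '' S i, ?_, Set.finite_iUnion fun i => (hfin i).image _⟩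
  rw [eq_top_iff, ← closure_iUnion_range_ofVertex, Subgroup.closure_le]
  refine Set.iUnion_subset fun i => ?_
  rw [← MonoidHom.coe_range, SetLike.coe_subset_coe, MonoidHom.range_eq_map, ← hS i,
    MonoidHom.map_closure]
  exact Subgroup.closure_mono (Set.subset_iUnion (fun i => ofVertex Γ i '' S i) i)

theorem normalClosure_graphProductRels_bot (G : ι → Type u) [∀ i, Group (G i)] :
    Subgroup.normalClosure (graphProductRels (⊥ : SimpleGraph ι) G) = ⊥ := by
  have : graphProductRels (⊥ : SimpleGraph ι) G = ∅ := by
    ext x; simp [graphProductRels]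
  rw [this, Subgroup.normalClosure_empty]

/-- The free product is the graph product along the graph without edges. -/
noncomputable def coprodEquivGraphProduct (G : ι → Type u) [∀ i, Group (G i)] :
    Monoid.CoprodI G ≃* GraphProduct (⊥ : SimpleGraph ι) G :=
  ((QuotientGroup.quotientMulEquivOfEq (normalClosure_graphProductRels_bot G)).trans
    QuotientGroup.quotientBot).symm

end Chain

/-! ## Lamplighter groups -/

section Lamplighter

-- Action on a cycle of fibres

theorem lampShift_apply (p : ℕ) (n : Multiplicative ℤ) (f : Multiplicative (ℤ →₀ ZMod p)) :
    Multiplicative.toAdd (lampShift p n f) =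
      (Multiplicative.toAdd f).mapDomain (· + Multiplicative.toAdd n) :=
  Finsupp.equivMapDomain_eq_mapDomain (Equiv.addRight (Multiplicative.toAdd n)) _

/-- The configuration `f` modulo `m`. -/
noncomputable def foldLamps {p : ℕ} (m : ℕ) (f : ℤ →₀ ZMod p) : ZMod m →₀ ZMod p :=
  f.mapDomain (Int.cast : ℤ → ZMod m)

theorem foldLamps_shift {p : ℕ} (m : ℕ) (f : ℤ →₀ ZMod p) (n : ℤ) (j : ZMod m) :
    foldLamps m (f.mapDomain (· + n)) (j + n) = foldLamps m f j := by
  have h : foldLamps m (f.mapDomain (· + n)) = (foldLamps m f).mapDomain (· + (n : ZMod m)) := by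
    rw [foldLamps, foldLamps, ← Finsupp.mapDomain_comp, ← Finsupp.mapDomain_comp]
    congr 1
    ext i
    simp
  rw [h]
  exact Finsupp.mapDomain_apply (add_left_injective _) _ _

theorem foldLamps_add {p : ℕ} (m : ℕ) (f f' : ℤ →₀ ZMod p) :
    foldLamps m (f + f') = foldLamps m f + foldLamps m f' :=
  Finsupp.mapDomain_add

/-- The imprimitive action of the lamplighter group on `m` copies of `ℤ/p` arranged in a cycle. -/
@[reducible]
noncomputable def lampAction (p m : ℕ) : MulAction (Lamplighter p) (ZMod p × ZMod m) where
  smul g x := (x.1 + foldLamps m (Multiplicative.toAdd g.left)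
    (x.2 + (Multiplicative.toAdd g.right : ℤ)), x.2 + (Multiplicative.toAdd g.right : ℤ))
  one_smul x := by
    change (x.1 + foldLamps m 0 (x.2 + ((0 : ℤ) : ZMod m)), x.2 + ((0 : ℤ) : ZMod m)) = x
    simp [foldLamps]
  mul_smul g h x := by
    have h1 : Multiplicative.toAdd (g * h).left = Multiplicative.toAdd g.left +
        (Multiplicative.toAdd h.left).mapDomain (· + Multiplicative.toAdd g.right) := by
      rw [SemidirectProduct.mul_left, toAdd_mul, lampShift_apply]
    have h2 : x.2 + ((Multiplicative.toAdd (g * h).right : ℤ) : ZMod m) =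
        x.2 + (Multiplicative.toAdd h.right : ℤ) + (Multiplicative.toAdd g.right : ℤ) := by
      rw [SemidirectProduct.mul_right, toAdd_mul, Int.cast_add]
      ring
    change (x.1 + foldLamps m (Multiplicative.toAdd (g * h).left)
      (x.2 + (Multiplicative.toAdd (g * h).right : ℤ)),
      x.2 + (Multiplicative.toAdd (g * h).right : ℤ)) = (x.1 + foldLamps m (Multiplicative.toAdd h.left)
      (x.2 + (Multiplicative.toAdd h.right : ℤ)) + foldLamps m (Multiplicative.toAdd g.left)
      (x.2 + (Multiplicative.toAdd h.right : ℤ) + (Multiplicative.toAdd g.right : ℤ)),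
      x.2 + (Multiplicative.toAdd h.right : ℤ) + (Multiplicative.toAdd g.right : ℤ))
    rw [h2, h1, foldLamps_add, Finsupp.add_apply, foldLamps_shift]
    congr 1
    abel

/-- The permutation representation of `lampAction`. -/
noncomputable def lampHom (p m : ℕ) : Lamplighter p →* Perm (ZMod p × ZMod m) :=
  @MulAction.toPermHom _ _ _ (lampAction p m)

theorem lampHom_apply (p m : ℕ) (g : Lamplighter p) (x : ZMod p × ZMod m) :
    lampHom p m g x = (x.1 + foldLamps m (Multiplicative.toAdd g.left)
      (x.2 + (Multiplicative.toAdd g.right : ℤ)), x.2 + (Multiplicative.toAdd g.right : ℤ)) :=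
  rfl

/-- The generator switching the lamp at `0`. -/
noncomputable def lampSwitch (p : ℕ) : Lamplighter p :=
  SemidirectProduct.inl (Multiplicative.ofAdd (Finsupp.single 0 1))

/-- The generator moving the lamplighter. -/
noncomputable def lampMove (p : ℕ) : Lamplighter p :=
  SemidirectProduct.inr (Multiplicative.ofAdd 1)

theorem closure_lampGens (p : ℕ) [NeZero p] :
    Subgroup.closure {lampSwitch p, lampMove p} = ⊤ := by
  set H := Subgroup.closure {lampSwitch p, lampMove p} with hH
  have hs : lampSwitch p ∈ H := Subgroup.subset_closure (by simp)
  have ht : lampMove p ∈ H := Subgroup.subset_closure (by simp)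
  have hr : ∀ n : Multiplicative ℤ, (SemidirectProduct.inr n : Lamplighter p) ∈ H := fun n => by
    have h1 : n = Multiplicative.ofAdd (1 : ℤ) ^ (Multiplicative.toAdd n) := by
      rw [← ofAdd_zsmul]; simp
    rw [h1, map_zpow]
    exact H.zpow_mem ht _
  have hl : ∀ f : ℤ →₀ ZMod p,
      (SemidirectProduct.inl (Multiplicative.ofAdd f) : Lamplighter p) ∈ H := fun f => by
    induction f using Finsupp.induction_linear with
    | zero => rw [ofAdd_zero, map_one]; exact H.one_mem
    | add f f' hf hf' => rw [ofAdd_add, map_mul]; exact H.mul_mem hf hf'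
    | single i c =>
      -- The lamp at i in state c is a conjugate, by a power of the move, of a power of the switch.
      have h1 : Multiplicative.ofAdd (Finsupp.single i c) =
          lampShift p (Multiplicative.ofAdd i)
            (Multiplicative.ofAdd (Finsupp.single 0 1) ^ c.val) := by
        apply Multiplicative.toAdd.injective
        rw [lampShift_apply, toAdd_pow, toAdd_ofAdd, toAdd_ofAdd, toAdd_ofAdd, Finsupp.smul_single,
          Finsupp.mapDomain_single]
        simp
      rw [h1, SemidirectProduct.inl_aut, map_pow]
      exact H.mul_mem (H.mul_mem (hr _) (H.pow_mem hs _)) (hr _)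
  refine (Subgroup.eq_top_iff' _).2 fun g => ?_
  rw [← SemidirectProduct.inl_left_mul_inr_right g]
  exact H.mul_mem (hl (Multiplicative.toAdd g.left)) (hr _)

-- Folded configurations and heights

theorem intCast_injOn {m : ℕ} {N : ℤ} (hN : 2 * N < m) :
    Set.InjOn (Int.cast : ℤ → ZMod m) {i | |i| ≤ N} := by
  intro a ha b hb hab
  simp only [Set.mem_ofPred_eq, abs_le] at ha hb
  have h1 := (ZMod.intCast_eq_intCast_iff_dvd_sub a b m).1 hab
  have h2 := Int.eq_zero_of_abs_lt_dvd h1 (abs_lt.2 ⟨by omega, by omega⟩)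
  omega

/-- Modulo a suitable power of two, a nontrivial configuration has a lit lamp far from `0`. -/
theorem exists_foldLamps_ne_zero {p : ℕ} {f : ℤ →₀ ZMod p} (hf : f ≠ 0) :
    ∃ k, ∃ j : ZMod (2 ^ k), foldLamps (2 ^ k) f j ≠ 0 ∧
      2 ^ k ≤ 4 * j.valMinAbs.natAbs + 1 := by
  classical
  have hex : ∃ k, foldLamps (2 ^ k) f ≠ 0 := by
    obtain ⟨N, hN⟩ := (f.support.image Int.natAbs).bddAbove
    refine ⟨N + 1, fun h => hf ?_⟩
    have hlt : 2 * (N : ℤ) < (2 ^ (N + 1) : ℕ) := by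
      rw [pow_succ, mul_comm]
      exact_mod_cast Nat.mul_lt_mul_of_pos_right Nat.lt_two_pow_self two_pos
    refine Finsupp.mapDomain_injOn _ (intCast_injOn hlt) ?_ ?_
      (h.trans Finsupp.mapDomain_zero.symm)
    · intro i hi
      have := hN (Finset.mem_coe.2 (Finset.mem_image_of_mem Int.natAbs hi))
      simp only [Set.mem_ofPred_eq, abs_le]
      omega
    · simp
  have hspec := Nat.find_spec hex
  have hmin := fun m => Nat.find_min hex (m := m)
  set k := Nat.find hex
  refine ⟨k, ?_⟩
  -- Here k is least with nonzero folding. If all lit lamps modulo 2^k lay within a quarter turn of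
  -- 0, reduction modulo 2^(k-1) would be injective on them, and the previous folding would be
  -- nonzero too.
  rcases hk : k with _ | m
  · rw [hk] at hspec
    obtain ⟨j, hj⟩ := Finsupp.ne_iff.1 hspec
    exact ⟨j, hj, by simp⟩
  by_contra! hcon
  rw [hk] at hspec
  have h0 : foldLamps (2 ^ m) f = 0 := not_not.1 (hmin m (by omega))
  have hdvd : 2 ^ m ∣ 2 ^ (m + 1) := pow_dvd_pow 2 (Nat.le_succ m)
  have hcomp : foldLamps (2 ^ m) f =
      (foldLamps (2 ^ (m + 1)) f).mapDomain (ZMod.castHom hdvd (ZMod (2 ^ m))) := by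
    rw [foldLamps, foldLamps, ← Finsupp.mapDomain_comp]
    congr 1
    ext i
    simp
  refine hspec (Finsupp.mapDomain_injOn
    {j : ZMod (2 ^ (m + 1)) | 4 * j.valMinAbs.natAbs + 1 < 2 ^ (m + 1)} ?_ ?_ (by simp)
    ((hcomp.symm.trans h0).trans Finsupp.mapDomain_zero.symm))
  · intro a ha b hb hab
    have hinj := intCast_injOn (m := 2 ^ m) (N := ((2 ^ m - 1) / 2 : ℕ)) (by
      have : 0 < 2 ^ m := by positivity
      omega)
    simp only [Set.mem_ofPred_eq, pow_succ] at ha hb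
    rw [← ZMod.coe_valMinAbs a, ← ZMod.coe_valMinAbs b, map_intCast, map_intCast] at hab
    have := hinj (x₁ := a.valMinAbs) (x₂ := b.valMinAbs) ?_ ?_ hab
    · exact ZMod.valMinAbs_inj.1 this
    · simp only [Set.mem_ofPred_eq, Int.abs_eq_natAbs]; omega
    · simp only [Set.mem_ofPred_eq, Int.abs_eq_natAbs]; omega
  · intro j hj
    exact hcon j (Finsupp.mem_support_iff.1 hj)

/-- A function on the cycle of fibres which is large far from the origin, with opposite signs on
the zero section and on its complement. -/
noncomputable def lampHeight (p m : ℕ) (x : ZMod p × ZMod m) : ℤ :=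
  if x.1 = 0 then x.2.valMinAbs.natAbs else -1 - x.2.valMinAbs.natAbs

theorem lampHeight_fiber (p m : ℕ) [NeZero p] [NeZero m] (c : ℤ) :
    {x | lampHeight p m x = c}.encard ≤ (p * 2 : ℕ) := by
  classical
  have : Fintype (ZMod p) := ZMod.fintype p
  set n : ZMod m := ((if 0 ≤ c then c else -1 - c : ℤ) : ZMod m)
  have hsub : {x | lampHeight p m x = c} ⊆
      ((Finset.univ ×ˢ {n, -n} : Finset (ZMod p × ZMod m)) : Set (ZMod p × ZMod m)) := by
    rintro ⟨z, j⟩ h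
    have key : (j.valMinAbs.natAbs : ℤ) = if 0 ≤ c then c else -1 - c := by
      simp only [lampHeight, Set.mem_ofPred_eq] at h
      split_ifs at h ⊢ <;> omega
    have hj : j = n ∨ j = -n := by
      have h0 := ZMod.coe_valMinAbs j
      simp only [n, ← key]
      rcases Int.natAbs_eq j.valMinAbs with h | h
      · left; rw [← h, h0]
      · right; rw [← Int.cast_neg, ← h, h0]
    simpa using hj
  refine (Set.encard_le_encard hsub).trans ?_
  rw [Set.encard_coe_eq_coe_finsetCard, Finset.card_product, Finset.card_univ, ZMod.card]
  exact_mod_cast Nat.mul_le_mul_left p Finset.card_le_two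

theorem lampHeight_lampMove (p m : ℕ) [NeZero m] (x : ZMod p × ZMod m) :
    (lampHeight p m (lampHom p m (lampMove p) x) - lampHeight p m x).natAbs ≤ 1 := by
  have h : lampHom p m (lampMove p) x = (x.1, x.2 + 1) := by
    rw [lampHom_apply]
    simp [lampMove, foldLamps]
  have h1 : ((1 : ZMod m).valMinAbs).natAbs ≤ 1 := by
    simpa using natAbs_valMinAbs_intCast_le m 1
  have h2 := (ZMod.natAbs_valMinAbs_add_le x.2 1).trans (Int.natAbs_add_le _ _)
  have h3 := (ZMod.natAbs_valMinAbs_add_le (x.2 + 1) (-1)).trans (Int.natAbs_add_le _ _)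
  rw [add_neg_cancel_right, ZMod.natAbs_valMinAbs_neg] at h3
  rw [h]
  simp only [lampHeight]
  split_ifs <;> omega

/-- The switch acts only on the fibre over 0, where the two possible heights are 0 and -1. -/
theorem lampHeight_lampSwitch (p m : ℕ) (x : ZMod p × ZMod m) :
    (lampHeight p m (lampHom p m (lampSwitch p) x) - lampHeight p m x).natAbs ≤ 1 := by
  classical
  have h : lampHom p m (lampSwitch p) x = (x.1 + if x.2 = 0 then 1 else 0, x.2) := by
    rw [lampHom_apply]
    simp [lampSwitch, foldLamps, Finsupp.single_apply, eq_comm]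
  rw [h]
  by_cases hx : x.2 = 0
  · simp only [lampHeight, hx, ZMod.valMinAbs_zero]
    split_ifs <;> simp
  · simp [hx]

/-- Elements with nonzero translation part are separated through the quotient ℤ. A pure
configuration changes the state over a far lit lamp j from zero to nonzero, so the height jumps from
|j| to -1 - |j|. -/
theorem linSep_lamplighter (p : ℕ) (hp : 2 ≤ p) : LinSep (2 * (p * 2 * 4)) (Lamplighter p) := by
  have : NeZero p := ⟨by omega⟩
  obtain ⟨L, hL⟩ := linSep_int
  refine LinSep.of_closure (closure_lampGens p) (fun s => max 1 (L s.right + L s.right⁻¹)) fun g hg => ?_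
  by_cases hr : g.right = 1
  · have hl : Multiplicative.toAdd g.left ≠ 0 := fun h =>
      hg (SemidirectProduct.ext (Multiplicative.toAdd.injective h) hr)
    obtain ⟨m, hm, j, hj, hk⟩ : ∃ m, NeZero m ∧ ∃ j : ZMod m,
        foldLamps m (Multiplicative.toAdd g.left) j ≠ 0 ∧ m ≤ 4 * j.valMinAbs.natAbs + 1 := by
      obtain ⟨k, hk⟩ := exists_foldLamps_ne_zero hl
      exact ⟨2 ^ k, inferInstance, hk⟩
    have hact : lampHom p m g (0, j) =
        (foldLamps m (Multiplicative.toAdd g.left) j, j) := by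
      rw [lampHom_apply, hr]
      simp
    -- D is that jump. Heights lie between -1 - ⌊m/2⌋ and ⌊m/2⌋, hence N = m + 2, and m ≤ 4|j| + 1
    -- gives N ≤ 8D.
    obtain ⟨f, hf⟩ := separates_of_range (D := 2 * j.valMinAbs.natAbs + 1) (N := m + 2)
      (a := -1 - (m / 2 : ℕ)) (x := ((0 : ZMod p), j)) (g := g)
      (T := {lampSwitch p, lampMove p}) (K := fun s => max 1 (L s.right + L s.right⁻¹)) (by omega)
      (lampHom p m) (lampHeight p m) (lampHeight_fiber p m) (by
        rw [hact]
        simp only [lampHeight, if_neg hj, if_true]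
        omega) (fun y => by
        have := ZMod.natAbs_valMinAbs_le y.2
        simp only [lampHeight]
        split_ifs <;> omega) (fun y => by
        have := ZMod.natAbs_valMinAbs_le y.2
        simp only [lampHeight]
        split_ifs <;> omega) (by omega) (by
        rintro s (rfl | rfl) y
        · exact (lampHeight_lampSwitch p _ y).trans (le_max_left _ _)
        · exact (lampHeight_lampMove p _ y).trans (le_max_left _ _))
    exact ⟨ZMod p × ZMod m, lampHom p m, f, _, hf⟩
  · obtain ⟨X, ρ, f, x, h⟩ := hL g.right hr
    refine ⟨X, ρ.comp SemidirectProduct.rightHom, f, x, h.base, h.pos, h.le, ?_, fun k =>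
      (h.fiber k).trans (by norm_cast; omega)⟩
    intro s _ y
    have h1 := h.lipschitz s.right y
    have h2 := h.lipschitz s.right⁻¹ (ρ s.right y)
    rw [← Perm.mul_apply, ← map_mul, inv_mul_cancel, map_one, Perm.one_apply] at h2
    have h3 := le_max_right 1 (L s.right + L s.right⁻¹)
    simp only [MonoidHom.comp_apply, SemidirectProduct.rightHom_eq_right]
    omega

theorem fg_lamplighter (p : ℕ) (hp : 2 ≤ p) : Group.FG (Lamplighter p) := by
  have : NeZero p := ⟨by omega⟩
  exact Group.fg_iff.2 ⟨_, closure_lampGens p, by simp⟩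

end Lamplighter

/-! ## The Grigorchuk group -/

section Grigorchuk

-- Self-similarity and action on levels

@[simp] theorem grigA_apply (l : List Bool) : grigA l = grigAFun l := rfl
@[simp] theorem grigB_apply (l : List Bool) : grigB l = grigBFun l := rfl
@[simp] theorem grigC_apply (l : List Bool) : grigC l = grigCFun l := rfl
@[simp] theorem grigD_apply (l : List Bool) : grigD l = grigDFun l := rfl

theorem grigA_mem : grigA ∈ grigorchukGroup := Subgroup.subset_closure (by simp)
theorem grigB_mem : grigB ∈ grigorchukGroup := Subgroup.subset_closure (by simp)
theorem grigC_mem : grigC ∈ grigorchukGroup := Subgroup.subset_closure (by simp)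
theorem grigD_mem : grigD ∈ grigorchukGroup := Subgroup.subset_closure (by simp)

theorem length_grigAFun (l : List Bool) : (grigAFun l).length = l.length := by
  cases l <;> simp [grigAFun]

theorem length_grigBCDFun (l : List Bool) : (grigBFun l).length = l.length ∧
    (grigCFun l).length = l.length ∧ (grigDFun l).length = l.length := by
  induction l with
  | nil => simp [grigBFun, grigCFun, grigDFun]
  | cons x l ih =>
    obtain ⟨hb, hc, hd⟩ := ih
    cases x <;> simp [grigBFun, grigCFun, grigDFun, length_grigAFun, hb, hc, hd]

theorem length_apply_of_mem {g : Perm (List Bool)} (hg : g ∈ grigorchukGroup) :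
    ∀ l, (g l).length = l.length := by
  induction hg using Subgroup.closure_induction with
  | mem s hs =>
    intro l
    obtain ⟨hb, hc, hd⟩ := length_grigBCDFun l
    rcases hs with rfl | rfl | rfl | rfl
    exacts [length_grigAFun l, hb, hc, hd]
  | one => simp
  | mul a b _ _ iha ihb => intro l; rw [Perm.mul_apply, iha, ihb]
  | inv a _ iha => intro l; rw [← iha, ← Perm.mul_apply, mul_inv_cancel, Perm.one_apply]

theorem apply_nil_of_mem {g : Perm (List Bool)} (hg : g ∈ grigorchukGroup) : g [] = [] :=
  List.length_eq_zero_iff.1 (length_apply_of_mem hg [])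

theorem exists_section_cons {g : Perm (List Bool)} (hg : g ∈ grigorchukGroup) :
    ∀ x, ∃ y, ∃ h ∈ grigorchukGroup, ∀ t, g (x :: t) = y :: h t := by
  induction hg using Subgroup.closure_induction with
  | mem s hs =>
    intro x
    rcases hs with rfl | rfl | rfl | rfl
    · exact ⟨!x, 1, one_mem _, fun t => rfl⟩
    · cases x
      · exact ⟨false, grigA, grigA_mem, fun t => by simp [grigBFun]⟩
      · exact ⟨true, grigC, grigC_mem, fun t => by simp [grigBFun]⟩
    · cases x
      · exact ⟨false, grigA, grigA_mem, fun t => by simp [grigCFun]⟩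
      · exact ⟨true, grigD, grigD_mem, fun t => by simp [grigCFun]⟩
    · cases x
      · exact ⟨false, 1, one_mem _, fun t => by simp [grigDFun]⟩
      · exact ⟨true, grigB, grigB_mem, fun t => by simp [grigDFun]⟩
  | one => exact fun x => ⟨x, 1, one_mem _, fun t => rfl⟩
  | mul a b _ _ iha ihb =>
    intro x
    obtain ⟨y, h, hh, hy⟩ := ihb x
    obtain ⟨z, k, hk, hz⟩ := iha y
    exact ⟨z, k * h, mul_mem hk hh, fun t => by rw [Perm.mul_apply, hy, hz, Perm.mul_apply]⟩
  | inv a ha iha =>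
    intro x
    -- The section of a⁻¹ at x is the inverse of the section of a at y = a⁻¹ x.
    obtain ⟨y, hy⟩ := List.length_eq_one_iff.1
      (length_apply_of_mem (g := a⁻¹) (inv_mem ha) [x])
    obtain ⟨z, h, hh, hz⟩ := iha y
    have h1 : z = x := by
      have := hz []
      rw [← hy, ← Perm.mul_apply, mul_inv_cancel, Perm.one_apply] at this
      exact (List.cons.inj this).1.symm
    refine ⟨y, h⁻¹, inv_mem hh, fun t => ?_⟩
    rw [Perm.inv_eq_iff_eq, hz, ← Perm.mul_apply, mul_inv_cancel, Perm.one_apply, h1]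

/-- Elements of the Grigorchuk group have sections in the Grigorchuk group. -/
theorem exists_section (v : List Bool) {g : Perm (List Bool)} (hg : g ∈ grigorchukGroup) :
    ∃ h ∈ grigorchukGroup, ∀ t, g (v ++ t) = g v ++ h t := by
  induction v generalizing g with
  | nil => exact ⟨g, hg, fun t => by simp [apply_nil_of_mem hg]⟩
  | cons x v ih =>
    obtain ⟨y, h, hh, hy⟩ := exists_section_cons hg x
    obtain ⟨k, hk, hv⟩ := ih hh
    exact ⟨k, hk, fun t => by rw [List.cons_append, hy, hy, hv, List.cons_append]⟩

/-- The section at a fixed vertex u permutes its two children; if it moves one, it swaps both. -/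
theorem apply_append_singleton {g : Perm (List Bool)} (hg : g ∈ grigorchukGroup) {u : List Bool}
    {e : Bool} (hu : g u = u) (he : g (u ++ [e]) ≠ u ++ [e]) (e' : Bool) :
    g (u ++ [e']) = u ++ [!e'] := by
  obtain ⟨h, hh, hs⟩ := exists_section u hg
  rw [hs, hu] at he
  obtain ⟨y, hy⟩ := List.length_eq_one_iff.1 (length_apply_of_mem hh [e])
  obtain ⟨z, hz⟩ := List.length_eq_one_iff.1 (length_apply_of_mem hh [!e])
  have hyz : y ≠ z := by
    rintro rfl
    simpa using h.injective (hy.trans hz.symm)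
  have hye : y ≠ e := by
    rintro rfl
    exact he (by rw [hy])
  rw [hs, hu]
  congr 1
  cases e <;> cases e' <;> cases y <;> cases z <;> simp_all

/-- The action of the Grigorchuk group on a level of the tree. -/
def levelHom (n : ℕ) : grigorchukGroup →* Perm (List.Vector Bool n) where
  toFun g := Perm.subtypePerm g.1 fun l => by rw [length_apply_of_mem g.2]
  map_one' := rfl
  map_mul' _ _ := rfl

@[simp]
theorem levelHom_apply_coe (n : ℕ) (g : grigorchukGroup) (l : List.Vector Bool n) :
    (levelHom n g l).1 = g.1 l.1 := rfl

theorem closure_grigGens : Subgroup.closure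
    {(⟨grigA, grigA_mem⟩ : grigorchukGroup), ⟨grigB, grigB_mem⟩, ⟨grigC, grigC_mem⟩,
      ⟨grigD, grigD_mem⟩} = ⊤ := by
  refine Eq.trans ?_ (Subgroup.closure_closure_coe_preimage (k := {grigA, grigB, grigC, grigD}))
  congr 1
  ext ⟨g, hg⟩
  change _ ↔ g ∈ ({grigA, grigB, grigC, grigD} : Set (Perm (List Bool)))
  simp

/-! ### The position of a vertex in the Schreier graph -/

/-- The position of a word in the Schreier graph of its level, which is a line (up to loops and
multiple edges) on which the words are ordered by a Gray code. -/
def grayPos : List Bool → ℕ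
  | [] => 0
  | x :: t => 2 * grayPos t + (grayPos t + if x then 0 else 1) % 2

theorem grayPos_cons_div (x : Bool) (t : List Bool) : grayPos (x :: t) / 2 = grayPos t := by
  rw [grayPos]; omega

theorem grayPos_grigAFun (l : List Bool) : grayPos (grigAFun l) / 2 = grayPos l / 2 := by
  cases l with
  | nil => rfl
  | cons x t => rw [grigAFun, grayPos_cons_div, grayPos_cons_div]

/-- While a preserves the pairs {2q, 2q + 1}, these generators preserve the complementary pairs {2q
- 1, 2q}. Hence every generator moves a position by at most 1. -/
theorem grayPos_grigBCDFun (l : List Bool) :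
    (grayPos (grigBFun l) + 1) / 2 = (grayPos l + 1) / 2 ∧
    (grayPos (grigCFun l) + 1) / 2 = (grayPos l + 1) / 2 ∧
    (grayPos (grigDFun l) + 1) / 2 = (grayPos l + 1) / 2 := by
  induction l with
  | nil => simp [grigBFun, grigCFun, grigDFun]
  | cons x t ih =>
    have ha := grayPos_grigAFun t
    obtain ⟨hb, hc, hd⟩ := ih
    cases x <;> simp only [grigBFun, grigCFun, grigDFun, grayPos] <;> simp <;> omega

theorem grayPos_lt (l : List Bool) : grayPos l < 2 ^ l.length := by
  induction l with
  | nil => simp [grayPos]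
  | cons x t ih => rw [grayPos, List.length_cons, pow_succ]; omega

theorem grayPos_injective {l l' : List Bool} (hl : l.length = l'.length)
    (h : grayPos l = grayPos l') : l = l' := by
  induction l generalizing l' with
  | nil => exact (List.length_eq_zero_iff.1 hl.symm).symm
  | cons x t ih =>
    obtain _ | ⟨x', t'⟩ := l'
    · simp at hl
    · have ht : grayPos t = grayPos t' := by
        rw [← grayPos_cons_div x t, ← grayPos_cons_div x' t', h]
      obtain rfl := ih (by simpa using hl) ht
      cases x <;> cases x' <;> simp [grayPos] at h ⊢ <;> omega

theorem grayPos_append_div (v t : List Bool) : grayPos (v ++ t) / 2 ^ v.length = grayPos t := by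
  induction v with
  | nil => simp
  | cons x v ih =>
    rw [List.cons_append, List.length_cons, pow_succ', ← Nat.div_div_eq_div_mul,
      grayPos_cons_div, ih]

theorem grayPos_append_true (t : List Bool) : grayPos (t ++ [true]) = grayPos t := by
  induction t with
  | nil => rfl
  | cons x t ih => rw [List.cons_append, grayPos, grayPos, ih]

/-- The code is reflected: a last digit 1 keeps the position, a last digit 0 mirrors it in the
doubled line. -/
theorem grayPos_append_false (t : List Bool) :
    grayPos (t ++ [false]) + grayPos t + 1 = 2 ^ (t.length + 1) := by
  induction t with
  | nil => rfl
  | cons x t ih =>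
    rw [List.cons_append, grayPos, grayPos, List.length_cons, pow_succ, ← ih]
    have := pow_succ 2 t.length
    omega

/-! ### Parity -/

/-- Both sides are homomorphisms to {±1}, so it is enough to compare them on a, b, c, d.
Consequently an element trivial on levels 2 and 3 is even on level 4, and cannot be a single
transposition there. -/
theorem sign_levelHom (g : grigorchukGroup) :
    Perm.sign (levelHom 4 g) = Perm.sign (levelHom 2 g) * Perm.sign (levelHom 3 g) := by
  have h : Perm.sign.comp (levelHom 4) =
      Perm.sign.comp (levelHom 2) * Perm.sign.comp (levelHom 3) := by
    refine MonoidHom.eq_of_eqOn_dense closure_grigGens ?_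
    rintro _ (rfl | rfl | rfl | rfl) <;>
      simp only [MonoidHom.comp_apply, MonoidHom.mul_apply] <;> decide
  exact DFunLike.congr_fun h g

/-- An element fixing the third level of the tree but not the fourth one moves a word of length four
whose prefix of length three is not the last one of the third level. -/
theorem exists_moved_of_fixes {g : Perm (List Bool)} (hg : g ∈ grigorchukGroup)
    (hfix : ∀ l, l.length ≤ 3 → g l = l) {l₀ : List Bool} (h₀ : l₀.length = 4)
    (hl₀ : g l₀ ≠ l₀) :
    ∃ t e, t.length = 3 ∧ grayPos t ≠ 7 ∧ g (t ++ [e]) ≠ t ++ [e] := by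
  by_contra! hcon
  have h4 := sign_levelHom ⟨g, hg⟩
  have h2 : levelHom 2 ⟨g, hg⟩ = 1 := by
    ext1 l
    exact Subtype.ext (hfix l.1 (by rw [l.2]; omega))
  have h3 : levelHom 3 ⟨g, hg⟩ = 1 := by
    ext1 l
    exact Subtype.ext (hfix l.1 l.2.le)
  have hsplit : ∀ l : List Bool, l.length = 4 → ∃ t e, t.length = 3 ∧ l = t ++ [e] := by
    intro l hl
    refine ⟨l.dropLast, l.getLast (by rintro rfl; simp at hl), by simp [hl], ?_⟩
    exact (List.dropLast_append_getLast _).symm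
  have htop : ∀ t : List Bool, t.length = 3 → grayPos t = 7 → t = [true, true, false] :=
    fun t ht h => grayPos_injective ht (h.trans rfl)
  let a : Bool → List.Vector Bool 4 := fun e => ⟨[true, true, false, e], rfl⟩
  have hmove : ∀ e, g [true, true, false, e] = [true, true, false, !e] := by
    obtain ⟨t, e, ht, rfl⟩ := hsplit l₀ h₀
    by_cases h7 : grayPos t = 7
    · obtain rfl := htop t ht h7
      exact fun e' => apply_append_singleton hg (hfix _ ht.le) hl₀ e'
    · exact (hl₀ (hcon t e ht h7)).elim
  -- If only the children of 110, the word in position 7, move, then level 4 sees one transposition,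
  -- which is odd.
  have hswap : levelHom 4 ⟨g, hg⟩ = swap (a false) (a true) := by
    ext1 l
    obtain ⟨t, e, ht, hte⟩ := hsplit l.1 l.2
    by_cases h7 : grayPos t = 7
    · obtain rfl := htop t ht h7
      have hl : l = a e := Subtype.ext hte
      have hval : levelHom 4 ⟨g, hg⟩ (a e) = a (!e) := Subtype.ext (hmove e)
      rw [hl, hval]
      cases e
      · exact (swap_apply_left _ _).symm
      · exact (swap_apply_right _ _).symm
    · have hl : levelHom 4 ⟨g, hg⟩ l = l := Subtype.ext (by
        rw [levelHom_apply_coe, hte]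
        exact hcon t e ht h7)
      have hne : ∀ e', l ≠ a e' := fun e' h => h7 (by
        have h1 : t ++ [e] = [true, true, false] ++ [e'] := hte.symm.trans (congrArg Subtype.val h)
        rw [(List.append_inj h1 ht).1]
        rfl)
      rw [hl, swap_apply_of_ne_of_ne (hne _) (hne _)]
  rw [hswap, h2, h3, Perm.sign_swap fun h => by
    exact absurd (congrArg Subtype.val h : [true, true, false, false] = [true, true, false, true])
      (by decide)] at h4
  simp at h4

/-- A nontrivial element of the Grigorchuk group moves a word of some length `n` to a word whose
position is at distance at least `2 ^ n / 8`. -/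
theorem exists_moved_far {g : Perm (List Bool)} (hg : g ∈ grigorchukGroup) (h1 : g ≠ 1) :
    ∃ l : List Bool, 2 ^ l.length ≤ 8 * ((grayPos (g l) : ℤ) - grayPos l).natAbs := by
  classical
  have hex : ∃ n, ∃ l : List Bool, l.length = n ∧ g l ≠ l := by
    by_contra! hcon
    exact h1 (Equiv.ext fun l => hcon _ l rfl)
  obtain ⟨l, hln, hl⟩ := Nat.find_spec hex
  have hmin : ∀ t : List Bool, t.length < l.length → g t = t := fun t ht => by
    by_contra hne
    exact Nat.find_min hex (hln ▸ ht) ⟨t, rfl, hne⟩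
  -- With n the first level moved by g, any displacement suffices if n ≤ 3, since 2^n ≤ 8. Otherwise
  -- the section at a prefix of length n - 4 fixes level 3 but not level 4.
  by_cases hn : l.length ≤ 3
  · refine ⟨l, ?_⟩
    have h2 : grayPos (g l) ≠ grayPos l := fun h =>
      hl (grayPos_injective (length_apply_of_mem hg l) h)
    have h3 : 2 ^ l.length ≤ 2 ^ 3 := Nat.pow_le_pow_right two_pos hn
    omega
  · obtain ⟨v, l₀, rfl, h₀⟩ : ∃ v l₀, l = v ++ l₀ ∧ l₀.length = 4 :=
      ⟨l.take (l.length - 4), l.drop (l.length - 4), (List.take_append_drop _ _).symm, by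
        rw [List.length_drop]; omega⟩
    rw [List.length_append, h₀] at hmin
    obtain ⟨h, hh, hs⟩ := exists_section v hg
    have hv : g v = v := hmin v (by omega)
    have hfix : ∀ t : List Bool, t.length ≤ 3 → h t = t := fun t ht => by
      have := hmin (v ++ t) (by rw [List.length_append]; omega)
      rw [hs, hv] at this
      exact List.append_cancel_left this
    obtain ⟨t, e, ht, h7, hte⟩ := exists_moved_of_fixes hh hfix h₀ fun h' =>
      hl (by rw [hs, hv, h'])
    refine ⟨v ++ t ++ [true], ?_⟩
    rw [apply_append_singleton (e := e) hg (hmin _ (by rw [List.length_append]; omega))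
      (by rw [List.append_assoc, hs, hv]; exact fun h' => hte (List.append_cancel_left h'))]
    -- The children of u = v ++ t are 2^n - 1 - 2 pos(u) apart. Since t is not in position 7, pos(u)
    -- < 7 · 2^(n-4), so this exceeds 2^n / 8.
    have h2 := grayPos_append_false (v ++ t)
    have h3 := grayPos_append_div v t
    have h4 := grayPos_lt t
    rw [ht] at h4
    have h5 : grayPos (v ++ t) < 7 * 2 ^ v.length := by
      rw [← Nat.div_lt_iff_lt_mul (by positivity)]
      omega
    rw [grayPos_append_true, Bool.not_true]
    simp only [List.length_append, List.length_singleton, ht] at h2 ⊢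
    have h6 : 2 ^ (v.length + 3 + 1) = 16 * 2 ^ v.length := by ring
    omega

theorem linSep_grigorchuk : LinSep (2 * (1 * 4)) grigorchukGroup := by
  refine LinSep.of_closure closure_grigGens (fun _ => 1) fun g hg => ?_
  obtain ⟨l, hl⟩ := exists_moved_far g.2 fun h => hg (Subtype.ext h)
  refine ⟨List.Vector Bool l.length, levelHom l.length, ?_⟩
  obtain ⟨f, hf⟩ := separates_of_range (C := 1) (N := 2 ^ l.length) (a := 0)
    (x := (⟨l, rfl⟩ : List.Vector Bool l.length)) (g := g)
    (T := {⟨grigA, grigA_mem⟩, ⟨grigB, grigB_mem⟩, ⟨grigC, grigC_mem⟩, ⟨grigD, grigD_mem⟩})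
    (K := fun _ => 1) (D := ((grayPos (g.1 l) : ℤ) - grayPos l).natAbs)
    (by have := Nat.two_pow_pos l.length; omega)
    (levelHom l.length) (fun y => (grayPos y.1 : ℤ)) (fun c => by
      refine Set.encard_le_one_iff.2 fun y z hy hz => Subtype.ext ?_
      exact grayPos_injective (y.2.trans z.2.symm) (by exact_mod_cast hy.trans hz.symm))
    rfl (fun y => Int.natCast_nonneg _) (fun y => by
      have := grayPos_lt y.1
      rw [y.2] at this
      rw [zero_add]
      exact_mod_cast this) hl (by
      intro s hs y
      have ha := grayPos_grigAFun y.1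
      obtain ⟨hb, hc, hd⟩ := grayPos_grigBCDFun y.1
      rcases hs with rfl | rfl | rfl | rfl <;>
        simp only [levelHom_apply_coe, grigA_apply, grigB_apply, grigC_apply, grigD_apply] <;>
        omega)
  exact ⟨f, _, hf⟩

theorem fg_grigorchuk : Group.FG grigorchukGroup :=
  Group.fg_iff.2 ⟨_, closure_grigGens, by simp⟩

end Grigorchuk

/-! ## The listed groups -/

theorem IsListedGroup.fg {G : Type u} [Group G] (h : IsListedGroup.{u, v} G) : Group.FG G := by
  rcases h with h | ⟨h, _⟩ | ⟨V, Γ, H, hH, ⟨e⟩⟩ | ⟨⟨e⟩⟩ | ⟨p, hp, ⟨e⟩⟩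
  · infer_instance
  · exact h
  · have := (Group.fg_iff_subgroup_fg H).2 hH
    exact Group.fg_of_surjective (f := e.symm.toMonoidHom) e.symm.surjective
  · have := fg_grigorchuk
    exact Group.fg_of_surjective (f := e.symm.toMonoidHom) e.symm.surjective
  · have := fg_lamplighter p hp
    exact Group.fg_of_surjective (f := e.symm.toMonoidHom) e.symm.surjective

theorem IsListedGroup.linSep {G : Type u} [Group G] (h : IsListedGroup.{u, v} G) :
    ∃ C, LinSep C G := by
  rcases h with h | ⟨h, hc⟩ | ⟨V, Γ, H, _, ⟨e⟩⟩ | ⟨⟨e⟩⟩ | ⟨p, hp, ⟨e⟩⟩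
  · exact ⟨_, linSep_of_finite G⟩
  · exact linSep_of_comm G h hc
  · exact ⟨_, (LinSep.graphProduct Γ fun _ => linSep_int).of_injective
      (H.subtype.comp e.toMonoidHom) (H.subtype_injective.comp e.injective)⟩
  · exact ⟨_, linSep_grigorchuk.of_injective e.toMonoidHom e.injective⟩
  · exact ⟨_, (linSep_lamplighter p hp).of_injective e.toMonoidHom e.injective⟩

end ActionGrowth

theorem proposition1p2 {ι : Type w} [Finite ι] (G : ι → Type u) [∀ i, Group (G i)]
    (hG : ∀ i, ActionGrowth.IsListedGroup.{u, v} (G i)) :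
    ActionGrowth.ClassCLin (Monoid.CoprodI G) ∧
      ∀ Γ : SimpleGraph ι, ActionGrowth.ClassCLin (ActionGrowth.GraphProduct Γ G) := by
  have hfg := fun Γ : SimpleGraph ι => ActionGrowth.fg_graphProduct Γ fun i => (hG i).fg
  choose C hC using fun i => (hG i).linSep
  -- Finiteness of the family gives a common fibre bound.
  obtain ⟨K, hK⟩ := (Set.finite_range C).bddAbove
  have hsep := fun Γ : SimpleGraph ι =>
    ActionGrowth.LinSep.graphProduct Γ fun i => (hC i).mono (hK (Set.mem_range_self i))
  let e := ActionGrowth.coprodEquivGraphProduct G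
  have := hfg ⊥
  exact ⟨((hsep ⊥).of_injective e.toMonoidHom e.injective).classCLin
      (Group.fg_of_surjective (f := e.symm.toMonoidHom) e.symm.surjective),
    fun Γ => (hsep Γ).classCLin (hfg Γ)⟩
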